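/- Let $\mathcal F$ be an ordinary differential field of characteristic $0$ with derivation $\delta$, and let $u$ be an element, differentially transcendental over $\mathcal F$, of a differential extension field of $\mathcal F$. Let $A\in\mathcal F\{x,y\}$ be an irreducible differential polynomial, and let $\mathrm{sat}(A)=[A]:(S_AI_A)^\infty$, where $[A]$ is the differential ideal generated by $A$, and $S_A$ and $I_A$ are the separant and the initial of $A$ under some ranking of the derivatives of $x,y$. Let $P_1,Q_1,P_2,Q_2\in\mathcal F\{u\}$ with $Q_i\neq 0$ and $\gcd(P_i,Q_i)=1$ for $i=1,2$, and put $\mathcal P(u)=\big(\tfrac{P_1(u)}{Q_1(u)},\tfrac{P_2(u)}{Q_2(u)}\big)$. Suppose that $\mathcal P(u)$ is a differential rational parametrization of the (unirational) differential curve $(\mathcal C,A)$, i.e. a generic point of it: for every $f\in\mathcal F\{x,y\}$, $f(\mathcal P(u))=0$ if and only if $f\in\mathrm{sat}(A)$. Suppose moreover that $\mathcal P(u)$ is linear: $\mathcal P(u)\notin\mathcal F^2$ and $P_1,Q_1,P_2,Q_2$ all have degree at most $1$ as polynomials in $u,u',u'',\dots$. For $z\in\{x,y,u\}$ let $\mathrm{ord}_z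 f$ be the largest $k$ such that $z^{(k)}$ occurs in $f$, with $\mathrm{ord}_z f=-\infty$ if no derivative $z^{(k)}$, $k\ge 0$, occurs in $f$, and let $\mathrm{ord}(P_i/Q_i)=\max\{\mathrm{ord}_uP_i,\mathrm{ord}_uQ_i\}$. Theorem. $\mathcal P(u)$ is proper, that is, the differential fields $\mathcal F\big\langle \tfrac{P_1(u)}{Q_1(u)},\tfrac{P_2(u)}{Q_2(u)}\big\rangle$ and $\mathcal F\langle u\rangle$ generated over $\mathcal F$ coincide, if and only if $$\mathrm{ord}\Big(\frac{P_1(u)}{Q_1(u)}\Big)=\mathrm{ord}_yA\quad\text{and}\quad \mathrm{ord}\Big(\frac{P_2(u)}{Q_2(u)}\Big)=\mathrm{ord}_xA .$$ -/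

import Mathlib

/-! Ordinary differential polynomials, saturation ideals, and rational parametrizations of
plane differential curves. A differential field is a field with a `Differential` structure;
`Differential.deriv` is its derivation `δ`. -/

/-- The differential polynomial ring over `F` in the differential indeterminates `y_i`, `i : σ`:
the variable `(i, k)` stands for the `k`-th derivative of `y_i`. -/
abbrev DiffPoly (σ F : Type*) [CommRing F] := MvPolynomial (σ × ℕ) F

namespace DiffPoly

variable {σ F : Type*} [CommRing F] [Differential F]

/-- Apply the derivation of `F` to every coefficient. -/
noncomputable def coeffDeriv (f : DiffPoly σ F) : DiffPoly σ F :=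
  f.support.sum fun m => MvPolynomial.monomial m (Differential.deriv (f.coeff m))

theorem coeff_coeffDeriv (f : DiffPoly σ F) (m : σ × ℕ →₀ ℕ) :
    (coeffDeriv f).coeff m = Differential.deriv (f.coeff m) := by
  classical
  simp only [coeffDeriv, MvPolynomial.coeff_sum, MvPolynomial.coeff_monomial,
    Finset.sum_ite_eq', MvPolynomial.mem_support_iff]
  split_ifs with h
  · rfl
  · rw [not_not.mp h, map_zero]

/-- The coefficientwise derivation, as a derivation of the polynomial ring. -/
noncomputable def coeffDerivation : Derivation ℤ (DiffPoly σ F) (DiffPoly σ F) :=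
  Derivation.mk'
    (AddMonoidHom.toIntLinearMap
      { toFun := coeffDeriv
        map_zero' := by ext m; simp [coeff_coeffDeriv]
        map_add' := fun f g => by ext m; simp [coeff_coeffDeriv] })
    (fun f g => by
      classical
      change coeffDeriv (f * g) = f • coeffDeriv g + g • coeffDeriv f
      ext m
      rw [smul_eq_mul, smul_eq_mul, mul_comm g, MvPolynomial.coeff_add, coeff_coeffDeriv,
        MvPolynomial.coeff_mul, MvPolynomial.coeff_mul, MvPolynomial.coeff_mul, map_sum,
        ← Finset.sum_add_distrib]
      refine Finset.sum_congr rfl fun p _ => ?_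
      rw [Derivation.leibniz, coeff_coeffDeriv, coeff_coeffDeriv, smul_eq_mul, smul_eq_mul,
        mul_comm (g.coeff p.2)])

/-- The derivation of `F{y_i : i ∈ σ}`: it extends that of `F` and sends `y_i^(k)` to
`y_i^(k+1)` (see `deriv_C` and `deriv_X`). -/
noncomputable instance instDifferential : Differential (DiffPoly σ F) where
  deriv := coeffDerivation + (MvPolynomial.mkDerivation F
    (fun v : σ × ℕ => (MvPolynomial.X (v.1, v.2 + 1) : DiffPoly σ F))).restrictScalars ℤ

theorem deriv_C (a : F) :
    Differential.deriv (MvPolynomial.C a : DiffPoly σ F) =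
      MvPolynomial.C (Differential.deriv a) := by
  classical
  change coeffDeriv (MvPolynomial.C a) + MvPolynomial.mkDerivation F _ (MvPolynomial.C a) = _
  rw [MvPolynomial.derivation_C, add_zero]
  ext m
  rw [coeff_coeffDeriv, MvPolynomial.coeff_C, MvPolynomial.coeff_C]
  split_ifs <;> simp

theorem deriv_X (v : σ × ℕ) :
    Differential.deriv (MvPolynomial.X v : DiffPoly σ F) = MvPolynomial.X (v.1, v.2 + 1) := by
  classical
  change coeffDeriv (MvPolynomial.X v) + MvPolynomial.mkDerivation F _ (MvPolynomial.X v) = _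
  rw [MvPolynomial.mkDerivation_X]
  have : coeffDeriv (MvPolynomial.X v : DiffPoly σ F) = 0 := by
    ext m
    rw [coeff_coeffDeriv, MvPolynomial.coeff_X, MvPolynomial.coeff_zero]
    split_ifs <;> simp
  rw [this, zero_add]

/-- The differential ideal `[f]` generated by `f`: the ideal generated by the derivatives
`f, f', f'', …`. -/
noncomputable def diffIdeal (f : DiffPoly σ F) : Ideal (DiffPoly σ F) :=
  Ideal.span (Set.range fun k : ℕ => (⇑Differential.deriv)^[k] f)

/-- `[f]` is closed under the derivation. -/
theorem deriv_mem_diffIdeal (f : DiffPoly σ F) {g : DiffPoly σ F} (hg : g ∈ diffIdeal f) :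
    Differential.deriv g ∈ diffIdeal f := by
  refine Submodule.span_induction ?_ ?_ ?_ ?_ hg
  · rintro _ ⟨k, rfl⟩
    refine Ideal.subset_span ⟨k + 1, ?_⟩
    exact Function.iterate_succ_apply' _ _ _
  · rw [map_zero]
    exact Ideal.zero_mem _
  · intro a b _ _ ha hb
    rw [map_add]
    exact Ideal.add_mem _ ha hb
  · intro a b hb hb'
    rw [smul_eq_mul, Derivation.leibniz, smul_eq_mul, smul_eq_mul]
    exact Ideal.add_mem _ (Ideal.mul_mem_left _ _ hb') (Ideal.mul_mem_right _ _ hb)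

/-- `ord i f` is the largest `k` such that `y_i^(k)` occurs in `f`, and `⊥` (that is, `-∞`) if
neither `y_i` nor any of its derivatives occurs in `f`. -/
noncomputable def ord {σ F : Type*} [CommRing F] (i : σ) (f : DiffPoly σ F) : WithBot ℕ :=
  open Classical in (f.vars.filter fun v => v.1 = i).sup fun v => (v.2 : WithBot ℕ)

/-- A ranking: a total order on the derivatives `y_i^(k)`, compatible with the derivation. -/
structure IsRanking {σ : Type*} (r : σ × ℕ → σ × ℕ → Prop) : Prop where
  isStrictTotalOrder : IsStrictTotalOrder (σ × ℕ) r
  lt_deriv : ∀ v, r v (v.1, v.2 + 1)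
  deriv_lt_deriv : ∀ v w, r v w → r (v.1, v.2 + 1) (w.1, w.2 + 1)

/-- `v` is the leader of `f`: the highest derivative occurring in `f`. -/
def IsLeader {σ F : Type*} [CommRing F] (r : σ × ℕ → σ × ℕ → Prop) (f : DiffPoly σ F)
    (v : σ × ℕ) : Prop :=
  v ∈ f.vars ∧ ∀ w ∈ f.vars, w ≠ v → r w v

/-- The leading coefficient of `f`, written as a univariate polynomial in the variable `v`;
for the leader `v` of `f` this is the initial of `f`. -/
noncomputable def initial {σ F : Type*} [CommRing F] (f : DiffPoly σ F) (v : σ × ℕ) :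
    DiffPoly σ F :=
  (f.support.filter fun m => m v = f.degreeOf v).sum fun m =>
    MvPolynomial.monomial (m.erase v) (f.coeff m)

/-- The partial derivative of `f` with respect to `v`; for the leader `v` of `f` this is the
separant of `f`. -/
noncomputable def separant {σ F : Type*} [CommRing F] (f : DiffPoly σ F) (v : σ × ℕ) :
    DiffPoly σ F :=
  MvPolynomial.pderiv v f

/-- The saturation ideal `sat(f) = [f] : (S_f I_f)^∞`, where `v` is the leader of `f`. -/
noncomputable def sat (f : DiffPoly σ F) (v : σ × ℕ) : Ideal (DiffPoly σ F) where
  carrier := {g | ∃ m : ℕ, (separant f v * initial f v) ^ m * g ∈ diffIdeal f}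
  zero_mem' := ⟨0, by rw [mul_zero]; exact Ideal.zero_mem _⟩
  add_mem' := by
    rintro a b ⟨m, hm⟩ ⟨n, hn⟩
    refine ⟨m + n, ?_⟩
    rw [mul_add]
    refine Ideal.add_mem _ ?_ ?_
    · rw [pow_add, mul_comm (_ ^ m), mul_assoc]
      exact Ideal.mul_mem_left _ _ hm
    · rw [pow_add, mul_assoc]
      exact Ideal.mul_mem_left _ _ hn
  smul_mem' := by
    rintro c a ⟨m, hm⟩
    refine ⟨m, ?_⟩
    rw [smul_eq_mul, mul_left_comm]
    exact Ideal.mul_mem_left _ _ hm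

section Extension

variable {E : Type*} [Field E] [Differential E]

/-- Evaluation of differential polynomials at a point `η`: `y_i^(k)` is sent to `δ^k (η i)`. -/
noncomputable def evalAt {σ F : Type*} [Field F] [Algebra F E] (η : σ → E) :
    DiffPoly σ F →ₐ[F] E :=
  MvPolynomial.aeval fun v => (⇑Differential.deriv)^[v.2] (η v.1)

/-- `𝕀(η)`: the ideal of all differential polynomials over `F` that vanish at `η`. -/
noncomputable def vanishingIdeal {σ : Type*} (F : Type*) [Field F] [Algebra F E] (η : σ → E) :
    Ideal (DiffPoly σ F) :=
  RingHom.ker (evalAt (F := F) η)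

end Extension

end DiffPoly

/-- `u` is differentially transcendental over `F`. -/
def IsDiffTranscendental (F : Type*) {E : Type*} [Field F] [Field E] [Differential E]
    [Algebra F E] (u : E) : Prop :=
  AlgebraicIndependent F fun k : ℕ => (⇑Differential.deriv)^[k] u

/-- The differential field `F⟨S⟩` generated over `F` by a subset `S` of `E`. -/
def diffAdjoin (F : Type*) {E : Type*} [Field F] [Field E] [Differential E]
    [Algebra F E] (S : Set E) : IntermediateField F E :=
  IntermediateField.adjoin F {b | ∃ a ∈ S, ∃ k : ℕ, b = (⇑Differential.deriv)^[k] a}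

/-- The point `(P₁(u)/Q₁(u), P₂(u)/Q₂(u))`. -/
noncomputable def ratPoint {F E : Type*} [Field F] [Field E] [Differential E] [Algebra F E]
    (P Q : Fin 2 → DiffPoly Unit F) (u : E) : Fin 2 → E :=
  fun i => DiffPoly.evalAt (fun _ => u) (P i) / DiffPoly.evalAt (fun _ => u) (Q i)

/-- The order of a differential rational function `p / q` in reduced form. -/
noncomputable def ratOrd {F : Type*} [Field F] (p q : DiffPoly Unit F) : WithBot ℕ :=
  max (DiffPoly.ord () p) (DiffPoly.ord () q)

/-- For an irreducible `A ∈ F{x, y}` with leader `v` (the indeterminate `x` has index `0` and `y`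
has index `1`) and `u` differentially transcendental over `F`: `(P₁(u)/Q₁(u), P₂(u)/Q₂(u))` is
a differential rational parametrization, in reduced form, of the curve defined by `A`, that is,
a generic point of `sat(A)`. -/
structure IsRatParametrization {F E : Type*} [Field F] [Differential F] [Field E]
    [Differential E] [Algebra F E] (A : DiffPoly (Fin 2) F) (v : Fin 2 × ℕ)
    (P Q : Fin 2 → DiffPoly Unit F) (u : E) : Prop where
  denom_ne_zero : ∀ i, Q i ≠ 0
  reduced : ∀ i, IsRelPrime (P i) (Q i)
  generic : DiffPoly.vanishingIdeal F (ratPoint P Q u) = DiffPoly.sat A v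

/-- The pair `(P₁(u)/Q₁(u), P₂(u)/Q₂(u))`, in reduced form, is linear: it does not lie in `F²`,
and all numerators and denominators have degree at most one. -/
structure IsLinearRat {F E : Type*} [Field F] [Field E] [Differential E] [Algebra F E]
    (P Q : Fin 2 → DiffPoly Unit F) (u : E) : Prop where
  not_const : ¬ ∀ i, ratPoint P Q u i ∈ Set.range (algebraMap F E)
  degree_num : ∀ i, (P i).totalDegree ≤ 1
  degree_denom : ∀ i, (Q i).totalDegree ≤ 1

/-- The parametrization is proper: `F⟨P₁(u)/Q₁(u), P₂(u)/Q₂(u)⟩ = F⟨u⟩`. -/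
def IsProperParam {F E : Type*} [Field F] [Field E] [Differential E] [Algebra F E]
    (P Q : Fin 2 → DiffPoly Unit F) (u : E) : Prop :=
  diffAdjoin F (Set.range (ratPoint P Q u)) = diffAdjoin F {u}

/-! Everything is read off in the space of Kähler differentials of `E` over `F`. Write `x`, `y` for
the two components, `m`, `n` for their orders in `u`, and `a`, `b` for the orders of `A` in `x` and
`y`. In characteristic zero algebraic independence passes to linear independence of differentials,
so the `du^(j)` are independent over `E`.

Linear side. If `α = (p₀ + p(u)) / (q₀ + q(u))`, the linear form `ξ = α q - p` takes the value `p₀ -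
α q₀` at `u`. Differentiating this identity `k` times and applying `d` shows that, modulo the
`dα^(i)` with `i < k`, `dα^(k)` is a nonzero multiple of the form `ξ^(k)` read in the `du^(j)`. Its
leading term sits at `du^(ord α + k)`. Hence the first `m` differentials `du^(j)` together with the
first `k` differentials `dx^(i)` span exactly the first `m + k` of the `du^(j)`, and likewise for
`y` and `n` (`spanLT_sup_spanLT_D`).

Curve side. An element of `sat(A)` free of proper derivatives of the leader is a multiple of `A`
(`dvd_of_mem_sat`). So the partial derivatives of `A` by its variables do not vanish at the point,
and `dx^(a+k)` and `dy^(b+k)` depend on lower differentials. When `A` involves both indeterminates,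
the first `a + k` of the `dx^(i)` and the first `b + k` of the `dy^(i)` span dimension `a + b + k`
(`finrank_spanLT_sup_of_ord_eq`).

If the parametrization is proper, the `dx^(i)` and `dy^(i)` span all `du^(j)`, and comparing
dimensions forces `m = b` and `n = a`. Conversely these equalities make the span of `n + 1` of the
`dx^(i)` and `m + 1` of the `dy^(i)` fill the first `n + m + 1` of the `du^(j)`, so it contains
`du`. In general that would only make `u` algebraic over the subfield; here the forms `ξ^(k)` have
coefficients and values in the subfield, so linear algebra yields `u` itself
(`mem_of_single_mem_span`). A constant component is treated apart: then `A` is, up to a unit, `x -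
c` or `y - c`. -/

open scoped KaehlerDifferential

/-! ### Algebraic independence and Kähler differentials -/

section Kaehler

variable {F E : Type*} [Field F] [CharZero F] [Field E] [Algebra F E]

/-- In characteristic zero the differentials of a transcendence basis are linearly independent. -/
theorem IsTranscendenceBasis.linearIndependent_D {ι : Type*} {x : ι → E}
    (hx : IsTranscendenceBasis F x) :
    LinearIndependent E fun i => KaehlerDifferential.D F E (x i) := by
  let f : MvPolynomial ι F →ₐ[F] E := MvPolynomial.aeval x
  let _ : Algebra (MvPolynomial ι F) E := f.toRingHom.toAlgebra
  have : IsScalarTower F (MvPolynomial ι F) E :=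
    IsScalarTower.of_algebraMap_eq fun a => (f.commutes a).symm
  have hinj : Function.Injective (algebraMap (MvPolynomial ι F) E) := hx.1
  have : FaithfulSMul (MvPolynomial ι F) E :=
    (faithfulSMul_iff_algebraMap_injective _ _).mpr hinj
  have := hx.isAlgebraic
  have : Algebra.IsAlgebraic (MvPolynomial ι F) E :=
    Algebra.IsAlgebraic.of_ringHom_of_comp_eq (S := Algebra.adjoin F (Set.range x))
      hx.1.aevalEquiv (RingHom.id E) hx.1.aevalEquiv.surjective Function.injective_id
      (RingHom.ext fun p => by simp [f, RingHom.algebraMap_toAlgebra])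
  let _ := FractionRing.liftAlgebra (MvPolynomial ι F) E
  have : Algebra.IsAlgebraic (FractionRing (MvPolynomial ι F)) E :=
    Algebra.IsAlgebraic.extendScalars (IsFractionRing.injective (MvPolynomial ι F) _)
  have : CharZero (FractionRing (MvPolynomial ι F)) :=
    charZero_of_injective_algebraMap (algebraMap F (FractionRing (MvPolynomial ι F))).injective
  -- Algebraic in characteristic zero means separable, hence formally étale. Composed with the
  -- localization, this makes the differentials of `E` the base change of those of the polynomial
  -- ring, where the `dX_i` form a basis.
  have : Algebra.FormallyEtale (FractionRing (MvPolynomial ι F)) E :=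
    Algebra.FormallyEtale.of_isSeparable _ E
  have : Algebra.FormallyEtale (MvPolynomial ι F) (FractionRing (MvPolynomial ι F)) :=
    .of_isLocalization (nonZeroDivisors _)
  have : Algebra.FormallyEtale (MvPolynomial ι F) E :=
    .comp _ (FractionRing (MvPolynomial ι F)) _
  have key := ((KaehlerDifferential.mvPolynomialBasis F ι).baseChange E).linearIndependent.map'
    (KaehlerDifferential.tensorKaehlerEquivOfFormallyEtale F (MvPolynomial ι F) E).toLinearMap
    (LinearEquiv.ker _)
  have hD : (fun i => KaehlerDifferential.D F E (x i)) = fun i =>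
      KaehlerDifferential.tensorKaehlerEquivOfFormallyEtale F (MvPolynomial ι F) E
        ((KaehlerDifferential.mvPolynomialBasis F ι).baseChange E i) := by
    funext i
    simp [KaehlerDifferential.mvPolynomialBasis_apply, f, RingHom.algebraMap_toAlgebra]
  rw [hD]
  exact key

/-- In characteristic zero the differentials of algebraically independent elements are linearly
independent. -/
theorem AlgebraicIndependent.linearIndependent_D {ι : Type*} {x : ι → E}
    (hx : AlgebraicIndependent F x) :
    LinearIndependent E fun i => KaehlerDifferential.D F E (x i) := by
  obtain ⟨t, hst, ht⟩ := exists_isTranscendenceBasis_superset hx.to_subtype_range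
  have := ht.linearIndependent_D.comp
    (fun i => (⟨x i, hst (Set.mem_range_self i)⟩ : t))
    (fun i j h => hx.injective (Subtype.ext_iff.mp h))
  exact this

end Kaehler

/-! ### Dimension counts for spans of initial segments of sequences -/

section Counting

open Module Submodule

variable {K V : Type*} [Field K] [AddCommGroup V] [Module K V]

/-- The span of the first `n` terms of a sequence. -/
def spanLT (K : Type*) {V : Type*} [Field K] [AddCommGroup V] [Module K V]
    (f : ℕ → V) (n : ℕ) : Submodule K V :=
  span K (f '' Set.Iio n)

theorem spanLT_zero (f : ℕ → V) : spanLT K f 0 = ⊥ := by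
  simp [spanLT]

theorem spanLT_succ (f : ℕ → V) (n : ℕ) :
    spanLT K f (n + 1) = spanLT K f n ⊔ span K {f n} := by
  rw [spanLT, spanLT, ← span_union]
  congr 1
  ext x
  simp only [Set.mem_image, Set.mem_Iio, Set.mem_union, Set.mem_singleton_iff,
    Nat.lt_succ_iff_lt_or_eq]
  constructor
  · rintro ⟨i, h | rfl, rfl⟩
    · exact Or.inl ⟨i, h, rfl⟩
    · exact Or.inr rfl
  · rintro (⟨i, h, rfl⟩ | rfl)
    · exact ⟨i, Or.inl h, rfl⟩
    · exact ⟨n, Or.inr rfl, rfl⟩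

theorem mem_spanLT (f : ℕ → V) {i n : ℕ} (h : i < n) : f i ∈ spanLT K f n :=
  subset_span ⟨i, h, rfl⟩

theorem spanLT_mono (f : ℕ → V) {i n : ℕ} (h : i ≤ n) : spanLT K f i ≤ spanLT K f n :=
  span_mono (Set.image_mono (Set.Iio_subset_Iio h))

theorem spanLT_le_span_range (f : ℕ → V) (n : ℕ) : spanLT K f n ≤ span K (Set.range f) :=
  span_mono (Set.image_subset_range _ _)

instance (f : ℕ → V) (n : ℕ) : FiniteDimensional K (spanLT K f n) :=
  FiniteDimensional.span_of_finite K ((Set.finite_Iio n).image f)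

theorem spanLT_eq_span_range (f : ℕ → V) (n : ℕ) :
    spanLT K f n = span K (Set.range fun i : Fin n => f i) := by
  rw [spanLT]
  congr 1
  ext x; constructor
  · rintro ⟨i, hi, rfl⟩; exact ⟨⟨i, hi⟩, rfl⟩
  · rintro ⟨i, rfl⟩; exact ⟨i, i.2, rfl⟩

theorem finrank_spanLT_le (f : ℕ → V) (n : ℕ) : finrank K (spanLT K f n) ≤ n := by
  rw [spanLT_eq_span_range]
  exact (finrank_range_le_card _).trans (Fintype.card_fin n).le

theorem finrank_spanLT {f : ℕ → V} (hf : LinearIndependent K f) (n : ℕ) :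
    finrank K (spanLT K f n) = n := by
  rw [spanLT_eq_span_range]
  exact (finrank_span_eq_card (hf.comp _ Fin.val_injective)).trans (Fintype.card_fin n)

theorem finrank_spanLT_sup {f g : ℕ → V} {a b : ℕ}
    (h : LinearIndependent K
      (Sum.elim (fun i : Fin a => f i) (fun i : Fin b => g i))) :
    finrank K ↥(spanLT K f a ⊔ spanLT K g b) = a + b := by
  rw [spanLT_eq_span_range, spanLT_eq_span_range, ← span_union, ← Set.Sum.elim_range]
  exact (finrank_span_eq_card h).trans (by simp)

theorem span_range_le_iSup_spanLT (f : ℕ → V) : span K (Set.range f) ≤ ⨆ n, spanLT K f n := by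
  rw [span_le]
  rintro _ ⟨i, rfl⟩
  exact mem_iSup_of_mem (i + 1) (mem_spanLT f i.lt_succ_self)

theorem exists_mem_spanLT_sup {f g : ℕ → V} {x : V}
    (hx : x ∈ span K (Set.range f) ⊔ span K (Set.range g)) :
    ∃ n, x ∈ spanLT K f n ⊔ spanLT K g n := by
  obtain ⟨y, hy, z, hz, rfl⟩ := mem_sup.mp hx
  obtain ⟨i, hi⟩ := (mem_iSup_of_directed _
    (monotone_nat_of_le_succ fun n => spanLT_mono f n.le_succ).directed_le).mp
    (span_range_le_iSup_spanLT f hy)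
  obtain ⟨j, hj⟩ := (mem_iSup_of_directed _
    (monotone_nat_of_le_succ fun n => spanLT_mono g n.le_succ).directed_le).mp
    (span_range_le_iSup_spanLT g hz)
  exact ⟨max i j, add_mem_sup (spanLT_mono f (le_max_left _ _) hi)
    (spanLT_mono g (le_max_right _ _) hj)⟩

theorem exists_spanLT_le_sup {f g u : ℕ → V}
    (hu : ∀ j, u j ∈ span K (Set.range f) ⊔ span K (Set.range g)) (m : ℕ) :
    ∃ n, spanLT K u m ≤ spanLT K f n ⊔ spanLT K g n := by
  choose n hn using fun j => exists_mem_spanLT_sup (hu j)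
  refine ⟨(Finset.range m).sup n, span_le.mpr ?_⟩
  rintro _ ⟨j, hj, rfl⟩
  have : n j ≤ (Finset.range m).sup n := Finset.le_sup (Finset.mem_range.mpr hj)
  exact SetLike.le_def.mp (sup_le_sup (spanLT_mono f this) (spanLT_mono g this)) (hn j)

/-- When both segments grow by one, the new `y` is redundant once the new `x` is present; so only
the first `b` terms of `y` ever matter. -/
theorem spanLT_sup_eq_left {x y : ℕ → V} {a b : ℕ}
    (hy : ∀ k, y (b + k) ∈ spanLT K x (a + k + 1) ⊔ spanLT K y (b + k)) (k : ℕ) :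
    spanLT K x (a + k) ⊔ spanLT K y (b + k) = spanLT K x (a + k) ⊔ spanLT K y b := by
  induction k with
  | zero => rfl
  | succ k ih =>
    calc spanLT K x (a + k + 1) ⊔ spanLT K y (b + k + 1)
        = spanLT K x (a + k + 1) ⊔ spanLT K y (b + k) := by
          rw [spanLT_succ y, ← sup_assoc, sup_eq_left, span_singleton_le_iff_mem]
          exact hy k
      _ = (spanLT K x (a + k) ⊔ spanLT K y (b + k)) ⊔ span K {x (a + k)} := by
          rw [spanLT_succ x]; ac_rfl
      _ = spanLT K x (a + k + 1) ⊔ spanLT K y b := by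
          rw [ih, spanLT_succ x]; ac_rfl

/-- For large `N`, the first `m` terms of `u` lie in the span of the `x` and `y` segments, so the
first `m + a + N` do too: this gives `m ≤ b`. In the other direction the first `b` terms of `y` cost
only boundedly many `u`, so a long joint segment fits among the `u` reached by `x` alone: this gives
`b ≤ m`. -/
theorem eq_of_sup_spanLT_of_mem {x y u : ℕ → V} (hu : LinearIndependent K u) {m n a b : ℕ}
    (hx : ∀ k, spanLT K u m ⊔ spanLT K x k = spanLT K u (m + k))
    (hy : ∀ k, spanLT K u n ⊔ spanLT K y k = spanLT K u (n + k))
    (hyx : ∀ k, y (b + k) ∈ spanLT K x (a + k + 1) ⊔ spanLT K y (b + k))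
    (hdim : ∀ k, finrank K ↥(spanLT K x (a + k) ⊔ spanLT K y (b + k)) = a + b + k)
    (hmem : ∀ j, u j ∈ span K (Set.range x) ⊔ span K (Set.range y)) : m = b := by
  apply le_antisymm
  · obtain ⟨N, hN⟩ := exists_spanLT_le_sup hmem m
    have h1 : spanLT K u (m + (a + N)) ≤ spanLT K x (a + N) ⊔ spanLT K y (b + N) := by
      rw [← hx]
      refine sup_le (hN.trans (sup_le_sup (spanLT_mono _ (by omega)) (spanLT_mono _ (by omega))))
        le_sup_left
    have h2 := Submodule.finrank_mono h1
    rw [finrank_spanLT hu, hdim] at h2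
    omega
  -- The shift `n + b` is just long enough for the first `b` terms of `y`, which lie in the span of
  -- the first `n + b` terms of `u`, to be covered.
  · have h1 : spanLT K x (a + (n + b)) ⊔ spanLT K y (b + (n + b)) ≤
        spanLT K u (m + (a + (n + b))) := by
      rw [spanLT_sup_eq_left hyx]
      refine sup_le ((hx _).le.trans' le_sup_right) ?_
      exact ((hy b).le.trans' le_sup_right).trans (spanLT_mono _ (by omega))
    have h2 := Submodule.finrank_mono h1
    rw [finrank_spanLT hu, hdim] at h2
    omega

/-- Taking `n + 1` terms of `x` and `m + 1` of `y` gives a subspace of the span of `n + m + 1` terms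
of `u` with the same dimension, as in a square resultant system. -/
theorem mem_span_sup_of_sup_spanLT {x y u : ℕ → V} (hu : LinearIndependent K u) {m n : ℕ}
    (hx : ∀ k, spanLT K u m ⊔ spanLT K x k = spanLT K u (m + k))
    (hy : ∀ k, spanLT K u n ⊔ spanLT K y k = spanLT K u (n + k))
    (hdim : ∀ k, finrank K ↥(spanLT K x (n + k) ⊔ spanLT K y (m + k)) = n + m + k) :
    u 0 ∈ span K (Set.range x) ⊔ span K (Set.range y) := by
  have h1 : spanLT K x (n + 1) ⊔ spanLT K y (m + 1) ≤ spanLT K u (n + m + 1) := by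
    refine sup_le ((hx _).le.trans' le_sup_right |>.trans (spanLT_mono _ (by omega)))
      ((hy _).le.trans' le_sup_right |>.trans (spanLT_mono _ (by omega)))
  have h2 := Submodule.eq_of_le_of_finrank_eq h1 (by rw [hdim, finrank_spanLT hu])
  have h3 : u 0 ∈ spanLT K u (n + m + 1) := mem_spanLT u (Nat.succ_pos _)
  rw [← h2] at h3
  exact SetLike.le_def.mp (sup_le_sup (spanLT_le_span_range _ _) (spanLT_le_span_range _ _)) h3

theorem eq_zero_of_sup_spanLT_of_mem {x u : ℕ → V} (hu : LinearIndependent K u) {m : ℕ}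
    (hx : ∀ k, spanLT K u m ⊔ spanLT K x k = spanLT K u (m + k))
    (hmem : ∀ j, u j ∈ span K (Set.range x)) : m = 0 := by
  obtain ⟨N, hN⟩ := exists_spanLT_le_sup (f := x) (g := x) (K := K)
    (fun j => by rw [sup_idem]; exact hmem j) m
  rw [sup_idem] at hN
  have h1 : spanLT K u (m + N) ≤ spanLT K x N := by
    rw [← hx]; exact sup_le hN le_rfl
  have h2 := (Submodule.finrank_mono h1).trans (finrank_spanLT_le x N)
  rw [finrank_spanLT hu] at h2
  omega

/-- Each new term of `x` raises the dimension of the span of the corresponding `u` segment by one.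
-/
theorem notMem_spanLT_of_sup_spanLT {x u : ℕ → V} (hu : LinearIndependent K u) {m : ℕ}
    (hx : ∀ k, spanLT K u m ⊔ spanLT K x k = spanLT K u (m + k)) (k : ℕ) :
    x k ∉ spanLT K x k := by
  intro h
  have h1 : spanLT K u (m + (k + 1)) = spanLT K u (m + k) := by
    have h2 : span K {x k} ≤ spanLT K x k := by rwa [span_singleton_le_iff_mem]
    rw [← hx, ← hx, spanLT_succ, sup_eq_left.mpr h2]
  have h3 := congrArg (fun W : Submodule K V => finrank K W) h1
  simp only [finrank_spanLT hu] at h3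
  omega

end Counting

/-! ### Divisibility, partial derivatives and elimination of a variable -/

section MvPolynomialLemmas

open MvPolynomial

variable {τ F : Type*} [Field F]

theorem MvPolynomial.degreeOf_le_of_dvd {p q : MvPolynomial τ F} (h : p ∣ q) (hq : q ≠ 0) (i : τ) :
    p.degreeOf i ≤ q.degreeOf i := by
  obtain ⟨g, rfl⟩ := h
  rw [degreeOf_mul_eq (left_ne_zero_of_mul hq) (right_ne_zero_of_mul hq)]
  exact Nat.le_add_right _ _

theorem MvPolynomial.vars_subset_of_dvd {p q : MvPolynomial τ F} (h : p ∣ q) (hq : q ≠ 0) :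
    p.vars ⊆ q.vars := by
  intro i hi
  rw [mem_vars_iff_degreeOf_ne_zero] at hi ⊢
  have := degreeOf_le_of_dvd h hq i
  omega

theorem MvPolynomial.pderiv_mem_supported {s : Set τ} {p : MvPolynomial τ F}
    (hp : p ∈ supported F s) (i : τ) : pderiv i p ∈ supported F s := by
  classical
  rw [mem_supported] at hp ⊢
  intro j hj
  obtain ⟨d, hd, hjd⟩ := (mem_vars_iff_mem_support j).mp hj
  rw [mem_support_iff, coeff_pderiv] at hd
  refine hp ((mem_vars_iff_mem_support j).mpr
    ⟨d + Finsupp.single i 1, mem_support_iff.mpr (left_ne_zero_of_mul hd), ?_⟩)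
  rw [Finsupp.mem_support_iff] at hjd ⊢
  rw [Finsupp.add_apply]
  omega

theorem MvPolynomial.pderiv_ne_zero [CharZero F] {p : MvPolynomial τ F} {i : τ} (hi : i ∈ p.vars) :
    pderiv i p ≠ 0 := by
  obtain ⟨d, hd, hid⟩ := (mem_vars_iff_mem_support i).mp hi
  rw [Finsupp.mem_support_iff] at hid
  have hle : Finsupp.single i 1 ≤ d := by
    rw [Finsupp.single_le_iff]; omega
  refine ne_zero_iff.mpr ⟨d - Finsupp.single i 1, ?_⟩
  rw [coeff_pderiv, tsub_add_cancel_of_le hle]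
  refine mul_ne_zero (mem_support_iff.mp hd) ?_
  exact Nat.cast_add_one_ne_zero _

theorem MvPolynomial.degreeOf_pderiv_lt {p : MvPolynomial τ F} {i : τ} (hi : i ∈ p.vars) :
    (pderiv i p).degreeOf i < p.degreeOf i := by
  have h0 := mem_vars_iff_degreeOf_ne_zero.mp hi
  rw [degreeOf_lt_iff (Nat.pos_of_ne_zero h0)]
  intro m hm
  rw [mem_support_iff, coeff_pderiv] at hm
  have := monomial_le_degreeOf i (mem_support_iff.mpr (left_ne_zero_of_mul hm))
  simp only [Finsupp.add_apply, Finsupp.single_eq_same] at this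
  omega

theorem MvPolynomial.not_dvd_pderiv [CharZero F] {p : MvPolynomial τ F} {i : τ} (hi : i ∈ p.vars) :
    ¬ p ∣ pderiv i p := fun h =>
  (degreeOf_pderiv_lt hi).not_ge (degreeOf_le_of_dvd h (pderiv_ne_zero hi) i)

theorem MvPolynomial.notMem_vars_of_mem_supported {s : Set τ} {f : MvPolynomial τ F} {z : τ}
    (hf : f ∈ supported F s) (hz : z ∉ s) : z ∉ f.vars :=
  fun h => hz (mem_supported.mp hf h)

/-- Elimination of a variable `z` that is determined by an equation `S * z + T = 0`. -/
theorem MvPolynomial.exists_pow_mul_mem_span {z : τ} {G : Set (MvPolynomial τ F)}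
    {S T g : MvPolynomial τ F} (hG : ∀ p ∈ G, z ∉ p.vars) (hS : z ∉ S.vars) (hT : z ∉ T.vars)
    (hg : z ∉ g.vars) (hmem : g ∈ Ideal.span (insert (S * X z + T) G)) :
    ∃ j, S ^ j * g ∈ Ideal.span G := by
  classical
  let L := Localization.Away S
  -- Substitute `z = -T/S`: this kills `S * z + T` and leaves every polynomial free of `z`
  -- unchanged. Clearing denominators afterwards produces the power of `S`.
  let ψ : MvPolynomial τ F →+* L := (aeval fun w =>
    if w = z then -(algebraMap _ L T * IsLocalization.Away.invSelf S)
    else algebraMap (MvPolynomial τ F) L (X w) : MvPolynomial τ F →ₐ[F] L).toRingHom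
  have hψ : ∀ p : MvPolynomial τ F, z ∉ p.vars → ψ p = algebraMap _ L p := by
    intro p hp
    refine hom_congr_vars ?_ ?_ rfl
    · ext a
      exact (aeval_C _ a).trans (IsScalarTower.algebraMap_apply F (MvPolynomial τ F) L a)
    · intro i hi _
      have : i ≠ z := fun h => hp (h ▸ hi)
      simp [ψ, this]
  have h1 : ψ (S * X z + T) = 0 := by
    rw [map_add, map_mul, hψ S hS, hψ T hT]
    have : ψ (X z) = -(algebraMap _ L T * IsLocalization.Away.invSelf S) := by simp [ψ]
    rw [this]
    linear_combination (-algebraMap _ L T) * IsLocalization.Away.mul_invSelf (S := L) S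
  have h2 : algebraMap _ L g ∈ (Ideal.span G).map (algebraMap _ L) := by
    rw [← hψ g hg]
    have h3 := Ideal.mem_map_of_mem ψ hmem
    rw [Ideal.map_span] at h3
    refine (Ideal.span_le.mpr ?_) h3
    rintro _ ⟨p, rfl | hp, rfl⟩
    · rw [h1]; exact Ideal.zero_mem _
    · rw [hψ p (hG p hp)]
      exact Ideal.mem_map_of_mem _ (Ideal.subset_span hp)
  obtain ⟨⟨a, s⟩, hs⟩ := (IsLocalization.mem_map_algebraMap_iff (Submonoid.powers S) L).mp h2
  rw [← map_mul] at hs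
  obtain ⟨c, hc⟩ := (IsLocalization.eq_iff_exists (Submonoid.powers S) L).mp hs
  obtain ⟨i, hi⟩ := s.2
  obtain ⟨k, hk⟩ := c.2
  refine ⟨k + i, ?_⟩
  have : S ^ (k + i) * g = c * (g * s) := by
    rw [← hi, ← hk]; ring
  rw [this, hc]
  exact Ideal.mul_mem_left _ _ a.2

end MvPolynomialLemmas

namespace DiffPoly

open MvPolynomial

/-! ### The initial of a differential polynomial -/

section Initial

variable {σ F : Type*} [Field F]

theorem initial_mem_supported {A : DiffPoly σ F} {s : Set (σ × ℕ)} (hA : A ∈ supported F s)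
    (v : σ × ℕ) : initial A v ∈ supported F s := by
  classical
  refine sum_mem fun m hm => ?_
  rw [mem_supported, vars_monomial (mem_support_iff.mp (Finset.mem_filter.mp hm).1)]
  intro w hw
  have hw' : w ∈ m.support := by
    rw [Finset.mem_coe, Finsupp.support_erase] at hw
    exact Finset.mem_of_mem_erase hw
  exact mem_supported.mp hA ((mem_vars_iff_mem_support w).mpr ⟨m, (Finset.mem_filter.mp hm).1, hw'⟩)

theorem degreeOf_initial (A : DiffPoly σ F) (v : σ × ℕ) : (initial A v).degreeOf v = 0 := by
  classical
  rw [← not_not (a := _ = 0), ← ne_eq, ← mem_vars_iff_degreeOf_ne_zero]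
  refine notMem_vars_of_mem_supported (s := {v}ᶜ) (sum_mem fun m hm => ?_) (by simp)
  rw [mem_supported, vars_monomial (mem_support_iff.mp (Finset.mem_filter.mp hm).1)]
  intro w hw
  rw [Finset.mem_coe, Finsupp.support_erase] at hw
  exact Finset.ne_of_mem_erase hw

theorem initial_ne_zero {A : DiffPoly σ F} (hA : A ≠ 0) (v : σ × ℕ) : initial A v ≠ 0 := by
  classical
  obtain ⟨m, hm, hmax⟩ := Finset.exists_mem_eq_sup A.support (support_nonempty.mpr hA) fun m => m v
  rw [← degreeOf_eq_sup] at hmax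
  refine ne_zero_iff.mpr ⟨m.erase v, ?_⟩
  rw [initial, coeff_sum, Finset.sum_eq_single_of_mem m (Finset.mem_filter.mpr ⟨hm, hmax.symm⟩)]
  · rw [coeff_monomial, if_pos rfl]
    exact mem_support_iff.mp hm
  · intro m' hm' hne
    rw [coeff_monomial, if_neg]
    intro h
    refine hne (Finsupp.ext fun w => ?_)
    by_cases hw : w = v
    · rw [hw, (Finset.mem_filter.mp hm').2, hmax]
    · simpa [Finsupp.erase_ne hw] using DFunLike.congr_fun h w

end Initial

/-! ### Reduction modulo the derivatives of `A` -/

section Reduction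

variable {σ F : Type*} [Field F] [Differential F]

/-- An increasing family of sets of derivatives, closed under derivation, such that the `k`-th
set does not contain `v^(k)` and the next one does. -/
structure IsLowerFamily {σ : Type*} (v : σ × ℕ) (B : ℕ → Set (σ × ℕ)) : Prop where
  deriv_mem : ∀ k, ∀ w ∈ B k, (w.1, w.2 + 1) ∈ B (k + 1)
  mono : ∀ k, B k ⊆ B (k + 1)
  self_mem : ∀ k, (v.1, v.2 + k) ∈ B (k + 1)
  notMem : ∀ k, (v.1, v.2 + k) ∉ B k

theorem IsLowerFamily.monotone {v : σ × ℕ} {B : ℕ → Set (σ × ℕ)} (hB : IsLowerFamily v B) :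
    Monotone B :=
  monotone_nat_of_le_succ hB.mono

theorem IsLowerFamily.insert_subset {v : σ × ℕ} {B : ℕ → Set (σ × ℕ)} (hB : IsLowerFamily v B) :
    insert v (B 0) ⊆ B 1 :=
  Set.insert_subset (hB.self_mem 0) (hB.mono 0)

theorem deriv_mem_supported {s t : Set (σ × ℕ)} (hst : s ⊆ t)
    (h : ∀ w ∈ s, (w.1, w.2 + 1) ∈ t) {f : DiffPoly σ F} (hf : f ∈ supported F s) :
    Differential.deriv f ∈ supported F t := by
  induction hf using Algebra.adjoin_induction with
  | mem x hx =>
    obtain ⟨w, hw, rfl⟩ := hx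
    rw [deriv_X]
    exact X_mem_supported.mpr (h w hw)
  | algebraMap a =>
    rw [MvPolynomial.algebraMap_eq, deriv_C]
    exact Subalgebra.algebraMap_mem _ _
  | add x y _ _ hx hy => rw [map_add]; exact add_mem hx hy
  | mul x y hx hy hx' hy' =>
    rw [Derivation.leibniz, smul_eq_mul, smul_eq_mul]
    exact add_mem (mul_mem (supported_mono hst hx) hy') (mul_mem (supported_mono hst hy) hx')

theorem iterate_deriv_mem_supported {v : σ × ℕ} {B : ℕ → Set (σ × ℕ)} (hB : IsLowerFamily v B)
    {A : DiffPoly σ F} (hA : A ∈ supported F (insert v (B 0))) (k : ℕ) :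
    (⇑Differential.deriv)^[k] A ∈ supported F (B (k + 1)) := by
  induction k with
  | zero => exact supported_mono hB.insert_subset hA
  | succ k ih =>
    rw [Function.iterate_succ_apply']
    exact deriv_mem_supported (hB.mono _) (hB.deriv_mem _) ih

theorem deriv_sub_pderiv_mul_mem_supported {v : σ × ℕ} {B : ℕ → Set (σ × ℕ)}
    (hB : IsLowerFamily v B) {f : DiffPoly σ F} (hf : f ∈ supported F (insert v (B 0))) :
    Differential.deriv f - pderiv v f * X (v.1, v.2 + 1) ∈ supported F (B 1) := by
  classical
  induction hf using Algebra.adjoin_induction with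
  | mem x hx =>
    obtain ⟨w, hw, rfl⟩ := hx
    rw [deriv_X]
    by_cases h : w = v
    · subst h
      simp
    · have hw' : w ∈ B 0 := hw.resolve_left h
      rw [pderiv_X_of_ne h, zero_mul, sub_zero]
      exact X_mem_supported.mpr (hB.deriv_mem 0 w hw')
  | algebraMap a =>
    rw [MvPolynomial.algebraMap_eq, deriv_C, pderiv_C, zero_mul, sub_zero]
    exact Subalgebra.algebraMap_mem _ _
  | add x y _ _ hx hy =>
    have := add_mem hx hy
    convert this using 1
    rw [map_add, map_add]; ring
  | mul x y hx hy hx' hy' =>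
    have := add_mem (mul_mem (supported_mono hB.insert_subset hx) hy')
      (mul_mem (supported_mono hB.insert_subset hy) hx')
    convert this using 1
    rw [Derivation.leibniz, Derivation.leibniz]
    simp only [smul_eq_mul]; ring

/-- The derivatives `A^(k)`, `k ≥ 1`, are linear in `v^(k)`, with the separant as coefficient. -/
theorem iterate_deriv_sub_separant_mul_mem_supported {v : σ × ℕ} {B : ℕ → Set (σ × ℕ)}
    (hB : IsLowerFamily v B) {A : DiffPoly σ F} (hA : A ∈ supported F (insert v (B 0))) (k : ℕ) :
    (⇑Differential.deriv)^[k + 1] A - separant A v * X (v.1, v.2 + (k + 1)) ∈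
      supported F (B (k + 1)) := by
  induction k with
  | zero => exact deriv_sub_pderiv_mul_mem_supported hB hA
  | succ k ih =>
    have h1 := deriv_mem_supported (hB.mono _) (hB.deriv_mem _) ih
    have hS : separant A v ∈ supported F (B (0 + 1)) :=
      supported_mono hB.insert_subset (pderiv_mem_supported hA v)
    have h2 := deriv_mem_supported (hB.mono _) (hB.deriv_mem _) hS
    have h3 : Differential.deriv (separant A v) * X (v.1, v.2 + (k + 1)) ∈
        supported F (B (k + 1 + 1)) :=
      mul_mem (supported_mono (hB.monotone (by omega)) h2)
        (X_mem_supported.mpr (hB.self_mem (k + 1)))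
    have h4 := add_mem h1 h3
    convert h4 using 1
    rw [Function.iterate_succ_apply' _ (k + 1), map_sub, Derivation.leibniz, deriv_X]
    simp only [smul_eq_mul, add_assoc]
    ring

/-- The highest derivative of `A` is the only generator containing the highest derivative of `v`,
and is linear in it with coefficient the separant. It can therefore be eliminated, and induction
descends to `A` alone. -/
theorem exists_separant_pow_mul_mem_span {v : σ × ℕ} {B : ℕ → Set (σ × ℕ)}
    (hB : IsLowerFamily v B) {A : DiffPoly σ F} (hA : A ∈ supported F (insert v (B 0)))
    (N : ℕ) {g : DiffPoly σ F} (hg : ∀ k, (v.1, v.2 + (k + 1)) ∉ g.vars)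
    (hmem : g ∈ Ideal.span ((fun k => (⇑Differential.deriv)^[k] A) '' Set.Iic N)) :
    ∃ j, separant A v ^ j * g ∈ Ideal.span {A} := by
  have hS : ∀ k, (v.1, v.2 + (k + 1)) ∉ (separant A v).vars := fun k =>
    notMem_vars_of_mem_supported (pderiv_mem_supported hA v) fun h =>
      hB.notMem (k + 1) (hB.monotone (by omega : 1 ≤ k + 1) (hB.insert_subset h))
  induction N generalizing g with
  | zero =>
    refine ⟨0, ?_⟩
    rw [pow_zero, one_mul]
    refine Ideal.span_mono ?_ hmem
    rintro _ ⟨k, hk, rfl⟩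
    rw [Set.mem_Iic, Nat.le_zero] at hk
    subst hk
    rfl
  | succ N ih =>
    obtain ⟨j, hj⟩ := exists_pow_mul_mem_span (z := (v.1, v.2 + (N + 1)))
      (G := (fun k => (⇑Differential.deriv)^[k] A) '' Set.Iic N) (S := separant A v)
      (T := (⇑Differential.deriv)^[N + 1] A - separant A v * X (v.1, v.2 + (N + 1))) (g := g)
      (by
        rintro _ ⟨k, hk, rfl⟩
        exact notMem_vars_of_mem_supported
          (supported_mono (hB.monotone (Nat.succ_le_succ hk)) (iterate_deriv_mem_supported hB hA k))
          (hB.notMem (N + 1)))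
      (hS N)
      (notMem_vars_of_mem_supported (iterate_deriv_sub_separant_mul_mem_supported hB hA N)
        (hB.notMem (N + 1)))
      (hg N)
      (by
        rw [add_sub_cancel]
        refine Ideal.span_mono ?_ hmem
        rintro _ ⟨k, hk, rfl⟩
        rcases Nat.le_succ_iff.mp hk with h | rfl
        · exact Or.inr ⟨k, h, rfl⟩
        · exact Or.inl rfl)
    obtain ⟨i, hi⟩ := ih (g := separant A v ^ j * g) (by
      classical
      intro k hk
      rcases Finset.mem_union.mp (vars_mul _ _ hk) with h | h
      · exact hS k (vars_pow _ _ h)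
      · exact hg k h) hj
    exact ⟨i + j, by rwa [pow_add, mul_assoc]⟩

/-- An element of `sat(A)` that contains no proper derivative of the leader is a multiple
of `A`. -/
theorem dvd_of_mem_sat [CharZero F] {v : σ × ℕ} {B : ℕ → Set (σ × ℕ)} (hB : IsLowerFamily v B)
    {A : DiffPoly σ F} (hirr : Irreducible A) (hA : A ∈ supported F (insert v (B 0)))
    (hv : v ∈ A.vars) {f : DiffPoly σ F} (hf : f ∈ sat A v)
    (hfree : ∀ k, (v.1, v.2 + (k + 1)) ∉ f.vars) : A ∣ f := by
  classical
  obtain ⟨m, hm⟩ := hf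
  obtain ⟨N, hN⟩ : ∃ N, (separant A v * initial A v) ^ m * f ∈
      Ideal.span ((fun k => (⇑Differential.deriv)^[k] A) '' Set.Iic N) := by
    rw [diffIdeal, ← Set.image_univ, ← Set.iUnion_Iic, Set.image_iUnion, Ideal.span_iUnion] at hm
    refine (Submodule.mem_iSup_of_directed _ (Monotone.directed_le fun i j hij => ?_)).mp hm
    exact Ideal.span_mono (Set.image_mono (Set.Iic_subset_Iic.mpr hij))
  have hs : ∀ {p : DiffPoly σ F}, p ∈ supported F (insert v (B 0)) →
      ∀ k, (v.1, v.2 + (k + 1)) ∉ p.vars := fun hp k =>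
    notMem_vars_of_mem_supported hp fun h =>
      hB.notMem (k + 1) (hB.monotone (by omega : 1 ≤ k + 1) (hB.insert_subset h))
  have hSI := pow_mem (mul_mem (pderiv_mem_supported hA v) (initial_mem_supported hA v)) m
  obtain ⟨j, hj⟩ := exists_separant_pow_mul_mem_span hB hA N (fun k hk => by
    rcases Finset.mem_union.mp (vars_mul _ _ hk) with h | h
    · exact hs hSI k h
    · exact hfree k h) hN
  rw [Ideal.mem_span_singleton] at hj
  -- The prime `A` divides neither separant nor initial, since both are nonzero and have smaller
  -- degree in the leader.
  have hp : Prime A := hirr.prime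
  have hS : ¬ A ∣ separant A v := not_dvd_pderiv hv
  have hI : ¬ A ∣ initial A v := fun h => by
    have := degreeOf_le_of_dvd h (initial_ne_zero hirr.ne_zero v) v
    rw [degreeOf_initial] at this
    exact mem_vars_iff_degreeOf_ne_zero.mp hv (Nat.le_zero.mp this)
  rcases hp.dvd_or_dvd hj with h | h
  · exact absurd (hp.dvd_of_dvd_pow h) hS
  · rcases hp.dvd_or_dvd h with h | h
    · rcases hp.dvd_or_dvd (hp.dvd_of_dvd_pow h) with h | h
      · exact absurd h hS
      · exact absurd h hI
    · exact h

end Reduction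

end DiffPoly

namespace DiffPoly

open MvPolynomial

/-! ### Differentials of derivatives at a point of the curve -/

section Evaluation

variable {σ F E : Type*} [Field F] [Differential F] [Field E] [Differential E] [Algebra F E]
  [DifferentialAlgebra F E]

theorem evalAt_deriv (η : σ → E) (f : DiffPoly σ F) :
    evalAt η (Differential.deriv f) = Differential.deriv (evalAt η f) := by
  induction f using MvPolynomial.induction_on with
  | C a =>
    rw [deriv_C, evalAt, aeval_C, aeval_C, deriv_algebraMap]
  | add p q hp hq => simp only [map_add, hp, hq]
  | mul_X p w hp =>
    have hX : ∀ z : σ × ℕ, evalAt η (X z : DiffPoly σ F) =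
      (⇑Differential.deriv)^[z.2] (η z.1) := fun z => aeval_X _ z
    rw [Derivation.leibniz, map_mul, Derivation.leibniz, deriv_X]
    simp only [smul_eq_mul, map_add, map_mul, hX, hp, Function.iterate_succ_apply']

theorem evalAt_iterate_deriv (η : σ → E) (f : DiffPoly σ F) (k : ℕ) :
    evalAt η ((⇑Differential.deriv)^[k] f) = (⇑Differential.deriv)^[k] (evalAt η f) := by
  induction k with
  | zero => rfl
  | succ k ih => rw [Function.iterate_succ_apply', evalAt_deriv, ih, Function.iterate_succ_apply']

end Evaluation

section Differentials

variable {σ E : Type*} (F : Type*) [Field F] [Field E] [Differential E] [Algebra F E]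

/-- The Kähler differential of the derivative `w` evaluated at `η`. -/
noncomputable def diffAt (η : σ → E) (w : σ × ℕ) : Ω[E⁄F] :=
  KaehlerDifferential.D F E ((⇑Differential.deriv)^[w.2] (η w.1))

variable {F}

theorem D_evalAt_mem_span (η : σ → E) {s : Set (σ × ℕ)} {f : DiffPoly σ F}
    (hf : f ∈ supported F s) :
    KaehlerDifferential.D F E (evalAt η f) ∈ Submodule.span E (diffAt F η '' s) := by
  induction hf using Algebra.adjoin_induction with
  | mem x hx =>
    obtain ⟨w, hw, rfl⟩ := hx
    rw [evalAt, aeval_X]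
    exact Submodule.subset_span ⟨w, hw, rfl⟩
  | algebraMap a => simp
  | add x y _ _ hx hy => rw [map_add, map_add]; exact add_mem hx hy
  | mul x y _ _ hx hy =>
    rw [map_mul, Derivation.leibniz]
    exact add_mem (Submodule.smul_mem _ _ hy) (Submodule.smul_mem _ _ hx)

/-- The chain rule, with the contribution of `v` isolated. -/
theorem D_evalAt_sub_mem_span (η : σ → E) {s : Set (σ × ℕ)} {v : σ × ℕ} {f : DiffPoly σ F}
    (hf : f ∈ supported F (insert v s)) :
    KaehlerDifferential.D F E (evalAt η f) - evalAt η (pderiv v f) • diffAt F η v ∈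
      Submodule.span E (diffAt F η '' s) := by
  classical
  induction hf using Algebra.adjoin_induction with
  | mem x hx =>
    obtain ⟨w, hw, rfl⟩ := hx
    rw [evalAt, aeval_X]
    by_cases h : w = v
    · subst h
      rw [pderiv_X_self, map_one, one_smul]
      exact (sub_self (diffAt F η w)).symm ▸ zero_mem _
    · rw [pderiv_X_of_ne h, map_zero, zero_smul, sub_zero]
      exact Submodule.subset_span ⟨w, hw.resolve_left h, rfl⟩
  | algebraMap a =>
    rw [MvPolynomial.algebraMap_eq, pderiv_C, map_zero, zero_smul, evalAt, aeval_C]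
    simp
  | add x y _ _ hx hy =>
    have := add_mem hx hy
    convert this using 1
    simp only [map_add, add_smul]; abel
  | mul x y _ _ hx hy =>
    have := add_mem (Submodule.smul_mem _ (evalAt η x) hy) (Submodule.smul_mem _ (evalAt η y) hx)
    convert this using 1
    simp only [map_mul, map_add, Derivation.leibniz, smul_eq_mul]
    module

variable [Differential F] [DifferentialAlgebra F E]

/-- The differentials of the derivatives of `v` at a zero of `A` that is not a zero of
`∂A/∂v` depend linearly on the lower ones. -/
theorem diffAt_mem_span {η : σ → E} {v : σ × ℕ} {B : ℕ → Set (σ × ℕ)} (hB : IsLowerFamily v B)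
    {A : DiffPoly σ F} (hA : A ∈ supported F (insert v (B 0))) (h0 : evalAt η A = 0)
    (hS : evalAt η (separant A v) ≠ 0) (k : ℕ) :
    diffAt F η (v.1, v.2 + k) ∈ Submodule.span E (diffAt F η '' B k) := by
  cases k with
  | zero =>
    have := D_evalAt_sub_mem_span η hA
    rw [h0, map_zero, zero_sub, neg_mem_iff] at this
    exact (Submodule.smul_mem_iff _ hS).mp this
  | succ k =>
    have h1 := D_evalAt_mem_span η (iterate_deriv_sub_separant_mul_mem_supported hB hA k)
    have h2 := D_evalAt_mem_span η (supported_mono (hB.monotone (by omega : 1 ≤ k + 1))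
      (supported_mono hB.insert_subset (pderiv_mem_supported hA v)))
    have hX : evalAt η (X (v.1, v.2 + (k + 1)) : DiffPoly σ F) =
      (⇑Differential.deriv)^[v.2 + (k + 1)] (η v.1) := aeval_X _ _
    rw [map_sub, evalAt_iterate_deriv, h0, iterate_map_zero, zero_sub, map_mul, map_neg,
      neg_mem_iff, Derivation.leibniz, hX] at h1
    have h3 := (Submodule.add_mem_iff_left _ (Submodule.smul_mem _ _ h2)).mp h1
    exact (Submodule.smul_mem_iff _ hS).mp h3

end Differentials

/-! ### Lower families from rankings and from orders -/

section Families

variable {σ : Type*}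

theorem IsRanking.trans {r : σ × ℕ → σ × ℕ → Prop} (hr : IsRanking r) {a b c : σ × ℕ}
    (h : r a b) (h' : r b c) : r a c :=
  have := hr.isStrictTotalOrder
  _root_.trans h h'

theorem IsRanking.lt_add {r : σ × ℕ → σ × ℕ → Prop} (hr : IsRanking r) (v : σ × ℕ) (k : ℕ) :
    r v (v.1, v.2 + (k + 1)) := by
  induction k with
  | zero => exact hr.lt_deriv v
  | succ k ih => exact hr.trans ih (hr.lt_deriv _)

theorem IsRanking.isLowerFamily {r : σ × ℕ → σ × ℕ → Prop} (hr : IsRanking r) (v : σ × ℕ) :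
    IsLowerFamily v fun k => {w | r w (v.1, v.2 + k)} where
  deriv_mem k w hw := hr.deriv_lt_deriv _ _ hw
  mono k w hw := hr.trans hw (hr.lt_deriv _)
  self_mem k := hr.lt_deriv _
  notMem k := by
    have := hr.isStrictTotalOrder
    exact irrefl_of r _

theorem IsLeader.mem_supported {F : Type*} [Field F] {r : σ × ℕ → σ × ℕ → Prop}
    {f : DiffPoly σ F} {v : σ × ℕ} (h : IsLeader r f v) :
    f ∈ supported F (insert v {w | r w (v.1, v.2 + 0)}) := by
  rw [MvPolynomial.mem_supported]
  intro w hw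
  by_cases hwv : w = v
  · exact Or.inl hwv
  · exact Or.inr (h.2 w hw hwv)

theorem IsLeader.le_of_mem_vars {F : Type*} [Field F] {r : σ × ℕ → σ × ℕ → Prop}
    (hr : IsRanking r) {f : DiffPoly σ F} {v : σ × ℕ} (h : IsLeader r f v) {k : ℕ}
    (hk : (v.1, k) ∈ f.vars) : k ≤ v.2 := by
  by_contra! hlt
  obtain ⟨d, rfl⟩ := Nat.exists_eq_add_of_lt hlt
  have h1 := h.2 _ hk (fun h => by
    have := congrArg Prod.snd h
    dsimp only at this
    omega)
  have := hr.isStrictTotalOrder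
  exact asymm_of r h1 (hr.lt_add v d)

/-- The family cut out by the bound `c + k` on the order in `y_i` and the bound `d + k` on the
order in the other indeterminates. -/
def orderFamily (i : σ) (c d k : ℕ) : Set (σ × ℕ) :=
  {w | w.1 = i ∧ w.2 < c + k ∨ w.1 ≠ i ∧ w.2 < d + k}

/-- No ranking enters, so dependence relations can be obtained for either indeterminate, not only
that of the leader. -/
theorem isLowerFamily_orderFamily (i : σ) (c d : ℕ) :
    IsLowerFamily (i, c) (orderFamily i c d) where
  deriv_mem k w hw := hw.imp (fun h => ⟨h.1, Nat.succ_lt_succ h.2⟩)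
    fun h => ⟨h.1, Nat.succ_lt_succ h.2⟩
  mono k w hw := hw.imp (fun h => ⟨h.1, Nat.lt_succ_of_lt h.2⟩)
    fun h => ⟨h.1, Nat.lt_succ_of_lt h.2⟩
  self_mem k := by simp [orderFamily]
  notMem k := by simp [orderFamily]

end Families

/-! ### Generic points of `sat(A)` -/

section Generic

variable {σ F E : Type*} [Field F] [Differential F] [Field E] [Differential E]
  [Algebra F E] {r : σ × ℕ → σ × ℕ → Prop} {A : DiffPoly σ F} {v : σ × ℕ} {η : σ → E}

theorem evalAt_eq_zero_of_generic (h : vanishingIdeal F η = sat A v) : evalAt η A = 0 := by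
  have : A ∈ vanishingIdeal F η := by
    rw [h]
    refine ⟨0, ?_⟩
    rw [pow_zero, one_mul]
    exact Ideal.subset_span ⟨0, rfl⟩
  exact this

variable [CharZero F]

theorem dvd_of_evalAt_eq_zero (hA : Irreducible A) (hr : IsRanking r) (hv : IsLeader r A v)
    (h : vanishingIdeal F η = sat A v) {f : DiffPoly σ F} (hf : evalAt η f = 0)
    (hfree : ∀ k, (v.1, v.2 + (k + 1)) ∉ f.vars) : A ∣ f :=
  dvd_of_mem_sat (hr.isLowerFamily v) hA hv.mem_supported hv.1
    (h ▸ (hf : f ∈ vanishingIdeal F η)) hfree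

/-- A partial derivative of `A` contains no proper derivative of the leader, so vanishing at the
generic point would make it a multiple of `A`. The variable `w` need not be the leader. -/
theorem evalAt_pderiv_ne_zero (hA : Irreducible A) (hr : IsRanking r) (hv : IsLeader r A v)
    (h : vanishingIdeal F η = sat A v) {w : σ × ℕ} (hw : w ∈ A.vars) :
    evalAt η (pderiv w A) ≠ 0 := fun h0 => by
  refine not_dvd_pderiv hw (dvd_of_evalAt_eq_zero hA hr hv h h0 fun k hk => ?_)
  have h1 := MvPolynomial.mem_supported.mp
    (pderiv_mem_supported (mem_supported_vars A) w) hk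
  have := hv.le_of_mem_vars hr h1
  omega

/-- A nontrivial relation would be a nonzero multiple of `A`, hence would contain the leader, which
these variables exclude. -/
theorem algebraicIndependent_of_generic (hA : Irreducible A) (hr : IsRanking r)
    (hv : IsLeader r A v) (h : vanishingIdeal F η = sat A v) :
    AlgebraicIndependent F fun w : {w : σ × ℕ // w.1 ≠ v.1 ∨ w.2 < v.2} =>
      (⇑Differential.deriv)^[w.1.2] (η w.1.1) := by
  classical
  rw [algebraicIndependent_iff]
  intro p hp
  have hvars : ∀ w ∈ (rename Subtype.val p).vars, w.1 ≠ v.1 ∨ w.2 < v.2 := by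
    intro w hw
    obtain ⟨z, _, rfl⟩ := mem_vars_rename _ _ hw
    exact z.2
  have h0 : evalAt η (rename Subtype.val p) = 0 := by
    rw [evalAt, aeval_rename]
    exact hp
  have hdvd := dvd_of_evalAt_eq_zero hA hr hv h h0 fun k hk => by
    rcases hvars _ hk with h | h
    · exact h rfl
    · dsimp only at h; omega
  by_contra hne
  have hne' : rename Subtype.val p ≠ 0 := fun h =>
    hne (rename_injective _ Subtype.val_injective (h.trans (map_zero _).symm))
  rcases hvars v (vars_subset_of_dvd hdvd hne' hv.1) with h | h
  · exact h rfl
  · omega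

end Generic

/-! ### Orders of differential polynomials -/

section Order

variable {σ F : Type*} [Field F] {i : σ} {f : DiffPoly σ F}

theorem ord_def [DecidableEq σ] (i : σ) (f : DiffPoly σ F) :
    ord i f = (f.vars.filter fun v => v.1 = i).sup fun v => (v.2 : WithBot ℕ) := by
  rw [ord]
  congr

theorem le_ord {k : ℕ} (h : (i, k) ∈ f.vars) : (k : WithBot ℕ) ≤ ord i f := by
  classical
  rw [ord_def]
  have hk : (i, k) ∈ f.vars.filter fun v => v.1 = i := Finset.mem_filter.mpr ⟨h, rfl⟩
  exact Finset.le_sup (f := fun v : σ × ℕ => (v.2 : WithBot ℕ)) hk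

theorem notMem_vars_of_ord_eq_bot (h : ord i f = ⊥) (k : ℕ) : (i, k) ∉ f.vars := fun hk => by
  have := le_ord hk
  rw [h] at this
  exact WithBot.coe_ne_bot (le_bot_iff.mp this)

theorem le_of_ord_eq {n k : ℕ} (h : ord i f = n) (hk : (i, k) ∈ f.vars) : k ≤ n := by
  have := le_ord hk
  rw [h] at this
  exact WithBot.coe_le_coe.mp this

theorem mem_vars_of_ord_eq {n : ℕ} (h : ord i f = n) : (i, n) ∈ f.vars := by
  classical
  rw [ord_def] at h
  have hne : (f.vars.filter fun v => v.1 = i).Nonempty := by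
    rw [Finset.nonempty_iff_ne_empty]
    intro h0
    rw [h0, Finset.sup_empty] at h
    exact WithBot.bot_ne_coe h
  obtain ⟨w, hw, hsup⟩ := Finset.exists_mem_eq_sup _ hne fun v => (v.2 : WithBot ℕ)
  have h2 : (w.2 : WithBot ℕ) = n := hsup.symm.trans h
  obtain ⟨h3, h4⟩ := Finset.mem_filter.mp hw
  have h5 : w.2 = n := WithBot.coe_injective h2
  rwa [← h4, ← h5]

theorem ord_eq_coe_iff {n : ℕ} :
    ord i f = n ↔ (i, n) ∈ f.vars ∧ ∀ k, (i, k) ∈ f.vars → k ≤ n := by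
  refine ⟨fun h => ⟨mem_vars_of_ord_eq h, fun k => le_of_ord_eq h⟩, fun ⟨h, h'⟩ => ?_⟩
  refine le_antisymm ?_ (le_ord h)
  classical
  rw [ord_def]
  refine Finset.sup_le fun w hw => ?_
  obtain ⟨h1, rfl⟩ := Finset.mem_filter.mp hw
  exact WithBot.coe_le_coe.mpr (h' _ h1)

theorem ord_eq_bot_iff : ord i f = ⊥ ↔ ∀ k, (i, k) ∉ f.vars := by
  refine ⟨notMem_vars_of_ord_eq_bot, fun h => ?_⟩
  induction hn : ord i f using WithBot.recBotCoe with
  | bot => rfl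
  | coe n => exact absurd (mem_vars_of_ord_eq hn) (h n)

theorem IsLeader.ord_eq {r : σ × ℕ → σ × ℕ → Prop} (hr : IsRanking r) {v : σ × ℕ}
    (hv : IsLeader r f v) : ord v.1 f = v.2 :=
  ord_eq_coe_iff.mpr ⟨hv.1, fun _ hk => hv.le_of_mem_vars hr hk⟩

end Order

end DiffPoly

/-! ### Generated differential fields -/

section DiffAdjoin

variable {F E : Type*} [Field F] [Field E] [Algebra F E]

theorem IntermediateField.D_mem_span_of_mem_adjoin {S : Set E} {x : E}
    (hx : x ∈ IntermediateField.adjoin F S) :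
    KaehlerDifferential.D F E x ∈ Submodule.span E (KaehlerDifferential.D F E '' S) := by
  induction hx using IntermediateField.adjoin_induction with
  | mem x hx => exact Submodule.subset_span ⟨x, hx, rfl⟩
  | algebraMap a => simp
  | add x y _ _ hx hy => rw [map_add]; exact add_mem hx hy
  | inv x _ hx => rw [Derivation.leibniz_inv]; exact Submodule.smul_mem _ _ hx
  | mul x y _ _ hx hy =>
    rw [Derivation.leibniz]
    exact add_mem (Submodule.smul_mem _ _ hy) (Submodule.smul_mem _ _ hx)

variable [Differential E]

theorem iterate_deriv_mem_diffAdjoin {S : Set E} {a : E} (ha : a ∈ S) (k : ℕ) :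
    (⇑Differential.deriv)^[k] a ∈ diffAdjoin F S :=
  IntermediateField.subset_adjoin F _ ⟨a, ha, k, rfl⟩

variable [Differential F] [DifferentialAlgebra F E]

theorem deriv_mem_diffAdjoin {S : Set E} {x : E} (hx : x ∈ diffAdjoin F S) :
    Differential.deriv x ∈ diffAdjoin F S := by
  induction hx using IntermediateField.adjoin_induction with
  | mem x hx =>
    obtain ⟨a, ha, k, rfl⟩ := hx
    rw [← Function.iterate_succ_apply' (⇑Differential.deriv)]
    exact iterate_deriv_mem_diffAdjoin ha (k + 1)
  | algebraMap a => rw [deriv_algebraMap]; exact IntermediateField.algebraMap_mem _ _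
  | add x y _ _ hx hy => rw [map_add]; exact add_mem hx hy
  | inv x hx hx' =>
    rw [Derivation.leibniz_inv, smul_eq_mul]
    exact mul_mem (neg_mem (pow_mem (inv_mem hx) 2)) hx'
  | mul x y hx hy hx' hy' =>
    rw [Derivation.leibniz]
    exact add_mem (mul_mem hx hy') (mul_mem hy hx')

theorem iterate_deriv_mem_diffAdjoin_of_mem {S : Set E} {x : E} (hx : x ∈ diffAdjoin F S) (k : ℕ) :
    (⇑Differential.deriv)^[k] x ∈ diffAdjoin F S := by
  induction k with
  | zero => exact hx
  | succ k ih => rw [Function.iterate_succ_apply']; exact deriv_mem_diffAdjoin ih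

theorem diffAdjoin_le {S T : Set E} (h : ∀ x ∈ S, x ∈ diffAdjoin F T) :
    diffAdjoin F S ≤ diffAdjoin F T := by
  rw [diffAdjoin, IntermediateField.adjoin_le_iff]
  rintro _ ⟨a, ha, k, rfl⟩
  exact iterate_deriv_mem_diffAdjoin_of_mem (h a ha) k

end DiffAdjoin

/-! ### Linear differential forms with coefficients in `E` -/

section LinearForms

variable {E : Type*} [Field E] [Differential E]

/-- The derivation on linear differential forms `∑ c_j u^(j)`, with coefficients in `E`, in a
differential indeterminate `u`. -/
noncomputable def formDeriv : (ℕ →₀ E) →+ (ℕ →₀ E) :=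
  Finsupp.mapRange.addMonoidHom (Differential.deriv : Derivation ℤ E E).toLinearMap.toAddMonoidHom +
    Finsupp.mapDomain.addMonoidHom Nat.succ

theorem formDeriv_single (j : ℕ) (c : E) :
    formDeriv (Finsupp.single j c) =
      Finsupp.single j (Differential.deriv c) + Finsupp.single (j + 1) c := by
  simp [formDeriv]

theorem formDeriv_apply_zero (ξ : ℕ →₀ E) : formDeriv ξ 0 = Differential.deriv (ξ 0) := by
  have : Finsupp.mapDomain Nat.succ ξ 0 = 0 :=
    Finsupp.mapDomain_of_notMem_range _ _ (by simp)
  simp [formDeriv, this]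

theorem formDeriv_apply_succ (ξ : ℕ →₀ E) (j : ℕ) :
    formDeriv ξ (j + 1) = Differential.deriv (ξ (j + 1)) + ξ j := by
  have : Finsupp.mapDomain Nat.succ ξ (j + 1) = ξ j :=
    Finsupp.mapDomain_apply Nat.succ_injective ξ j
  simp [formDeriv, this]

/-- Evaluation of a linear differential form at `u`. -/
noncomputable def formEval (u : E) : (ℕ →₀ E) →ₗ[E] E :=
  Finsupp.linearCombination E fun j => (⇑Differential.deriv)^[j] u

theorem formEval_deriv (u : E) (ξ : ℕ →₀ E) :
    formEval u (formDeriv ξ) = Differential.deriv (formEval u ξ) := by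
  induction ξ using Finsupp.induction_linear with
  | zero => simp
  | add f g hf hg => simp only [map_add, hf, hg]
  | single j c =>
    simp only [formDeriv_single, map_add, formEval, Finsupp.linearCombination_single, smul_eq_mul,
      Derivation.leibniz, Function.iterate_succ_apply']
    ring

theorem formEval_iterate_deriv (u : E) (ξ : ℕ →₀ E) (k : ℕ) :
    formEval u (formDeriv^[k] ξ) = (⇑Differential.deriv)^[k] (formEval u ξ) := by
  induction k with
  | zero => rfl
  | succ k ih => rw [Function.iterate_succ_apply', formEval_deriv, ih, Function.iterate_succ_apply']

/-- The leading coefficient is unchanged by derivation, and the order increases by one. -/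
theorem iterate_formDeriv_apply {ξ : ℕ →₀ E} {m : ℕ} (h : ∀ j, m < j → ξ j = 0) (k : ℕ) :
    formDeriv^[k] ξ (m + k) = ξ m ∧ ∀ j, m + k < j → formDeriv^[k] ξ j = 0 := by
  induction k with
  | zero => exact ⟨rfl, h⟩
  | succ k ih =>
    rw [Function.iterate_succ_apply']
    constructor
    · rw [← add_assoc, formDeriv_apply_succ, ih.2 _ (Nat.lt_succ_self _), map_zero, zero_add, ih.1]
    · intro j hj
      obtain ⟨j, rfl⟩ := Nat.exists_eq_succ_of_ne_zero (by omega : j ≠ 0)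
      rw [Nat.succ_eq_add_one, formDeriv_apply_succ, ih.2 _ (by omega), ih.2 _ (by omega), map_zero,
        zero_add]

theorem iterate_formDeriv_apply_mem {L : Type*} [SetLike L E] [AddSubmonoidClass L E] {s : L}
    (hs : ∀ x ∈ s, Differential.deriv x ∈ s) {ξ : ℕ →₀ E} (h : ∀ j, ξ j ∈ s) (k j : ℕ) :
    formDeriv^[k] ξ j ∈ s := by
  induction k generalizing j with
  | zero => exact h j
  | succ k ih =>
    rw [Function.iterate_succ_apply']
    cases j with
    | zero => rw [formDeriv_apply_zero]; exact hs _ (ih 0)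
    | succ j => rw [formDeriv_apply_succ]; exact add_mem (hs _ (ih _)) (ih _)

variable (F : Type*) [Field F] [Algebra F E]

/-- The linear map sending `∑ c_j u^(j)` to `∑ c_j d(u^(j))`. -/
noncomputable def formDiff (u : E) : (ℕ →₀ E) →ₗ[E] Ω[E⁄F] :=
  Finsupp.linearCombination E fun j => KaehlerDifferential.D F E ((⇑Differential.deriv)^[j] u)

/-- The map sending `∑ c_j u^(j)` to `∑ u^(j) dc_j`. -/
noncomputable def formCoeffDiff (u : E) : (ℕ →₀ E) →ₗ[F] Ω[E⁄F] :=
  Finsupp.lsum F fun j =>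
    (⇑Differential.deriv)^[j] u • (KaehlerDifferential.D F E : E →ₗ[F] Ω[E⁄F])

theorem D_formEval (u : E) (ξ : ℕ →₀ E) :
    KaehlerDifferential.D F E (formEval u ξ) = formDiff F u ξ + formCoeffDiff F u ξ := by
  induction ξ using Finsupp.induction_linear with
  | zero => simp
  | add f g hf hg => simp only [map_add, hf, hg]; abel
  | single j c => simp [formEval, formDiff, formCoeffDiff]

theorem formCoeffDiff_mem (u : E) {ξ : ℕ →₀ E} {W : Submodule E Ω[E⁄F]}
    (h : ∀ j, KaehlerDifferential.D F E (ξ j) ∈ W) : formCoeffDiff F u ξ ∈ W := by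
  rw [formCoeffDiff, Finsupp.lsum_apply]
  exact sum_mem fun j _ => W.smul_mem _ (h j)

variable {F}

/-- If a span of linear forms with coefficients in `L` and values in `L` at `u` contains the form
`u`, then `u ∈ L`. -/
theorem mem_of_single_mem_span {L : IntermediateField F E} {u : E} {S : Set (ℕ →₀ E)}
    (hcoeff : ∀ s ∈ S, ∀ j, s j ∈ L) (heval : ∀ s ∈ S, formEval u s ∈ L)
    (h : Finsupp.single 0 1 ∈ Submodule.span E S) : u ∈ L := by
  obtain ⟨ρ, hρ⟩ := LinearMap.exists_leftInverse_of_injective (Algebra.linearMap L E)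
    (LinearMap.ker_eq_bot.mpr (algebraMap L E).injective)
  have hρ1 : ρ 1 = 1 := by simpa using LinearMap.congr_fun hρ 1
  -- An `L`-linear retraction of `E` onto `L`, applied coefficientwise, fixes the form `u` and turns
  -- an `E`-combination of `S` into an `L`-combination, which can then be evaluated inside `L`.
  let R : (ℕ →₀ E) →ₗ[L] (ℕ →₀ E) :=
    Finsupp.mapRange.linearMap ((Algebra.linearMap L E).comp ρ)
  have hR : ∀ (c : E), ∀ s ∈ S, R (c • s) = (ρ c : E) • s := by
    intro c s hs
    ext j
    have : c * s j = (⟨s j, hcoeff s hs j⟩ : L) • c := by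
      rw [Algebra.smul_def]; exact mul_comm _ _
    simp only [R, Finsupp.mapRange.linearMap_apply, Finsupp.mapRange_apply, Finsupp.smul_apply,
      smul_eq_mul, LinearMap.comp_apply, this, map_smul]
    exact mul_comm _ _
  obtain ⟨c, hc⟩ := (Finsupp.mem_span_iff_linearCombination E S _).mp h
  have h1 : formEval u (R (Finsupp.single 0 1)) ∈ L := by
    rw [← hc, Finsupp.linearCombination_apply, Finsupp.sum, map_sum, map_sum]
    refine sum_mem fun s _ => ?_
    rw [hR _ _ s.2, map_smul]
    exact mul_mem (ρ (c s)).2 (heval s s.2)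
  simpa [R, hρ1, formEval] using h1

end LinearForms

/-! ### Triangular changes of generators -/

section SpanLT

open Submodule

theorem spanLT_eq_of_smul_add_mem {K V : Type*} [Field K] [AddCommGroup V] [Module K V]
    {f g : ℕ → V} {c : K} (hc : c ≠ 0) (h : ∀ k, c • f k + g k ∈ spanLT K f k) (k : ℕ) :
    spanLT K f k = spanLT K g k := by
  induction k with
  | zero => rw [spanLT_zero, spanLT_zero]
  | succ k ih =>
    rw [spanLT_succ, spanLT_succ, ← ih]
    have hf : f k ∈ spanLT K f k ⊔ span K {g k} := by
      rw [← Submodule.smul_mem_iff _ hc, ← add_sub_cancel_right (c • f k) (g k)]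
      exact sub_mem (mem_sup_left (h k)) (mem_sup_right (mem_span_singleton_self _))
    have hg : g k ∈ spanLT K f k ⊔ span K {f k} := by
      rw [← add_sub_cancel_left (c • f k) (g k)]
      exact sub_mem (mem_sup_left (h k))
        (mem_sup_right (smul_mem _ _ (mem_span_singleton_self _)))
    apply le_antisymm
    · exact sup_le le_sup_left (by rwa [span_singleton_le_iff_mem])
    · exact sup_le le_sup_left (by rwa [span_singleton_le_iff_mem])

theorem spanLT_sup_eq_of_sub_mem {K V : Type*} [Field K] [AddCommGroup V] [Module K V]
    {f g : ℕ → V} {c : K} {m : ℕ} (hc : c ≠ 0)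
    (h : ∀ k, g k - c • f (m + k) ∈ spanLT K f (m + k)) (k : ℕ) :
    spanLT K f m ⊔ spanLT K g k = spanLT K f (m + k) := by
  induction k with
  | zero => rw [spanLT_zero, sup_bot_eq, add_zero]
  | succ k ih =>
    rw [spanLT_succ, ← sup_assoc, ih, ← add_assoc, spanLT_succ f]
    have hg : g k ∈ spanLT K f (m + k) ⊔ span K {f (m + k)} := by
      rw [← sub_add_cancel (g k) (c • f (m + k))]
      exact add_mem (mem_sup_left (h k))
        (mem_sup_right (smul_mem _ _ (mem_span_singleton_self _)))
    have hf : f (m + k) ∈ spanLT K f (m + k) ⊔ span K {g k} := by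
      rw [← Submodule.smul_mem_iff _ hc, ← sub_sub_cancel (g k) (c • f (m + k))]
      exact sub_mem (mem_sup_right (mem_span_singleton_self _)) (mem_sup_left (h k))
    apply le_antisymm
    · exact sup_le le_sup_left (by rwa [span_singleton_le_iff_mem])
    · exact sup_le le_sup_left (by rwa [span_singleton_le_iff_mem])

end SpanLT

/-! ### Differentials of linear fractions -/

section LinearFractions

open Submodule

variable {F E : Type*} [Field F] [Field E] [Algebra F E]

/-- A form with coefficients in `F`, seen as a form with coefficients in `E`. -/
noncomputable def baseForm (E : Type*) [Field E] [Algebra F E] (q : ℕ →₀ F) : ℕ →₀ E :=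
  q.mapRange (algebraMap F E) (map_zero _)

theorem baseForm_apply (q : ℕ →₀ F) (j : ℕ) : baseForm E q j = algebraMap F E (q j) :=
  Finsupp.mapRange_apply

variable [Differential E]

/-- `α = (p₀ + p(u)) / (q₀ + q(u))`, where `p` and `q` are linear differential forms over `F`. -/
structure IsLinearFraction (u α : E) (p₀ q₀ : F) (p q : ℕ →₀ F) : Prop where
  denom_ne_zero : algebraMap F E q₀ + formEval u (baseForm E q) ≠ 0
  eq_div : α = (algebraMap F E p₀ + formEval u (baseForm E p)) /
    (algebraMap F E q₀ + formEval u (baseForm E q))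

/-- The linear form `α q - p`, whose value at `u` is `p₀ - α q₀` if
`α = (p₀ + p(u)) / (q₀ + q(u))`. -/
noncomputable def fractionForm (α : E) (p q : ℕ →₀ F) : ℕ →₀ E :=
  α • baseForm E q - baseForm E p

theorem IsLinearFraction.formEval_fractionForm {u α : E} {p₀ q₀ : F} {p q : ℕ →₀ F}
    (h : IsLinearFraction u α p₀ q₀ p q) :
    formEval u (fractionForm α p q) = algebraMap F E p₀ - α * algebraMap F E q₀ := by
  have h1 := (eq_div_iff h.denom_ne_zero).mp h.eq_div
  rw [fractionForm, map_sub, map_smul, smul_eq_mul]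
  linear_combination h1

theorem formDiff_sub_mem_spanLT {u : E} {ξ : ℕ →₀ E} {n : ℕ} (hξ : ∀ j, n < j → ξ j = 0) :
    formDiff F u ξ - ξ n • KaehlerDifferential.D F E ((⇑Differential.deriv)^[n] u) ∈
      spanLT E (fun i => KaehlerDifferential.D F E ((⇑Differential.deriv)^[i] u)) n := by
  have h : formDiff F u ξ - ξ n • KaehlerDifferential.D F E ((⇑Differential.deriv)^[n] u) =
      formDiff F u (ξ.erase n) := by
    rw [sub_eq_iff_eq_add]
    conv_lhs => rw [← Finsupp.erase_add_single n ξ, map_add]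
    simp [formDiff]
  rw [h, formDiff, Finsupp.linearCombination_apply]
  refine sum_mem fun j hj => smul_mem _ _ (mem_spanLT _ ?_)
  rw [Finsupp.support_erase, Finset.mem_erase, Finsupp.mem_support_iff] at hj
  by_contra hlt
  exact hj.2 (hξ j (lt_of_le_of_ne (not_lt.mp hlt) (Ne.symm hj.1)))

theorem formCoeffDiff_smul_baseForm (u c : E) (q : ℕ →₀ F) :
    formCoeffDiff F u (c • baseForm E q) =
      formEval u (baseForm E q) • KaehlerDifferential.D F E c := by
  induction q using Finsupp.induction_linear with
  | zero => simp [baseForm]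
  | add f g hf hg =>
    have : baseForm E (f + g) = baseForm E f + baseForm E g :=
      Finsupp.mapRange_add (map_add _) f g
    rw [this, smul_add, map_add, map_add, hf, hg, add_smul]
  | single j a =>
    have : baseForm E (Finsupp.single j a) = Finsupp.single j (algebraMap F E a) :=
      Finsupp.mapRange_single
    rw [this, Finsupp.smul_single, smul_eq_mul, mul_comm c, ← Algebra.smul_def]
    simp only [formEval, formCoeffDiff, Finsupp.lsum_single, LinearMap.smul_apply,
      Finsupp.linearCombination_single, Derivation.coeFn_coe, Derivation.map_smul]
    rw [← algebraMap_smul E a (KaehlerDifferential.D F E c), smul_smul, smul_eq_mul, mul_comm]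

/-- The `F`-span of `1` and of the derivatives of `α` of order less than `k`. -/
noncomputable def affineSpanLT (F : Type*) {E : Type*} [Field F] [Field E] [Differential E]
    [Algebra F E] (α : E) (k : ℕ) : Submodule F E :=
  span F (insert 1 ((fun i => (⇑Differential.deriv)^[i] α) '' Set.Iio k))

theorem algebraMap_mem_affineSpanLT (α : E) (k : ℕ) (a : F) :
    algebraMap F E a ∈ affineSpanLT F α k := by
  rw [Algebra.algebraMap_eq_smul_one]
  exact smul_mem _ _ (subset_span (Set.mem_insert _ _))

theorem affineSpanLT_le_succ (α : E) (k : ℕ) : affineSpanLT F α k ≤ affineSpanLT F α (k + 1) :=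
  span_mono (Set.insert_subset_insert (Set.image_mono (Set.Iio_subset_Iio k.le_succ)))

theorem algebraMap_mul_mem_affineSpanLT (α : E) {i k : ℕ} (h : i < k) (a : F) :
    algebraMap F E a * (⇑Differential.deriv)^[i] α ∈ affineSpanLT F α k := by
  rw [← Algebra.smul_def]
  exact smul_mem _ _ (subset_span (Set.mem_insert_of_mem _ ⟨i, h, rfl⟩))

theorem D_mem_spanLT_of_mem_affineSpanLT {α x : E} {k : ℕ} (hx : x ∈ affineSpanLT F α k) :
    KaehlerDifferential.D F E x ∈
      spanLT E (fun i => KaehlerDifferential.D F E ((⇑Differential.deriv)^[i] α)) k := by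
  induction hx using span_induction with
  | mem x hx =>
    rcases hx with rfl | ⟨i, hi, rfl⟩
    · simp
    · exact mem_spanLT _ hi
  | zero => simp
  | add x y _ _ hx hy => rw [map_add]; exact add_mem hx hy
  | smul a x _ hx =>
    rw [Derivation.map_smul, ← algebraMap_smul E]
    exact smul_mem _ _ hx

variable [Differential F] [DifferentialAlgebra F E]

theorem deriv_mem_affineSpanLT {α x : E} {k : ℕ} (hx : x ∈ affineSpanLT F α k) :
    Differential.deriv x ∈ affineSpanLT F α (k + 1) := by
  induction hx using span_induction with
  | mem x hx =>
    rcases hx with rfl | ⟨i, hi, rfl⟩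
    · simp
    · dsimp only
      rw [← Function.iterate_succ_apply' (⇑Differential.deriv)]
      exact subset_span (Set.mem_insert_of_mem _ ⟨i + 1, Nat.succ_lt_succ hi, rfl⟩)
  | zero => simp
  | add x y _ _ hx hy => rw [map_add]; exact add_mem hx hy
  | smul a x hx hx' =>
    rw [Algebra.smul_def, Derivation.leibniz, deriv_algebraMap, smul_eq_mul, smul_eq_mul,
      mul_comm x, ← Algebra.smul_def, ← Algebra.smul_def]
    exact add_mem (smul_mem _ _ hx') (smul_mem _ _ (affineSpanLT_le_succ α k hx))

theorem deriv_sub_mem_affineSpanLT {α x : E} {a : F} {k : ℕ}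
    (hx : x - algebraMap F E a * (⇑Differential.deriv)^[k] α ∈ affineSpanLT F α k) :
    Differential.deriv x - algebraMap F E a * (⇑Differential.deriv)^[k + 1] α ∈
      affineSpanLT F α (k + 1) := by
  have h1 := deriv_mem_affineSpanLT hx
  have h2 := algebraMap_mul_mem_affineSpanLT α k.lt_succ_self (Differential.deriv a)
  convert add_mem h1 h2 using 1
  rw [map_sub, Derivation.leibniz, deriv_algebraMap, Function.iterate_succ_apply']
  simp only [smul_eq_mul]
  ring

/-- Only the term of top order `k` in `α` is tracked: the shift in `formDeriv` brings in
coefficients of lower order, so the coefficient of `α^(k)` stays `q j`. -/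
theorem iterate_formDeriv_fractionForm_sub_mem (α : E) (p q : ℕ →₀ F) (k j : ℕ) :
    formDeriv^[k] (fractionForm α p q) j - algebraMap F E (q j) * (⇑Differential.deriv)^[k] α ∈
      affineSpanLT F α k := by
  induction k generalizing j with
  | zero =>
    have h : fractionForm α p q j - algebraMap F E (q j) * α = algebraMap F E (-(p j)) := by
      simp only [fractionForm, Finsupp.sub_apply, Finsupp.smul_apply, baseForm_apply, smul_eq_mul,
        map_neg]
      ring
    exact h ▸ algebraMap_mem_affineSpanLT α 0 _
  | succ k ih =>
    rw [Function.iterate_succ_apply']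
    have h1 := deriv_sub_mem_affineSpanLT (ih j)
    cases j with
    | zero => rwa [formDeriv_apply_zero]
    | succ j =>
      have h2 := add_mem (affineSpanLT_le_succ α k (ih j))
        (algebraMap_mul_mem_affineSpanLT α k.lt_succ_self (q j))
      rw [sub_add_cancel] at h2
      rw [formDeriv_apply_succ, add_sub_right_comm]
      exact add_mem h1 h2

theorem iterate_deriv_sub_mul_mem (α : E) (p₀ q₀ : F) (k : ℕ) :
    (⇑Differential.deriv)^[k] (algebraMap F E p₀ - α * algebraMap F E q₀) -
      algebraMap F E (-q₀) * (⇑Differential.deriv)^[k] α ∈ affineSpanLT F α k := by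
  induction k with
  | zero =>
    have h : algebraMap F E p₀ - α * algebraMap F E q₀ - algebraMap F E (-q₀) * α =
      algebraMap F E p₀ := by
      rw [map_neg]; ring
    have h1 := algebraMap_mem_affineSpanLT α 0 p₀
    rwa [← h] at h1
  | succ k ih =>
    rw [Function.iterate_succ_apply']
    exact deriv_sub_mem_affineSpanLT ih

namespace IsLinearFraction

variable {u α : E} {p₀ q₀ : F} {p q : ℕ →₀ F}

/-- Apply `d` to the value of the `k`-th derivative `ξ` of the form `α q - p`. Modulo lower
`dα^(i)`, that value contributes `-q₀ dα^(k)` and the coefficients of `ξ` contribute `q(u) dα^(k)`;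
together they give the denominator as factor. -/
theorem smul_D_add_formDiff_mem (h : IsLinearFraction u α p₀ q₀ p q) (k : ℕ) :
    (algebraMap F E q₀ + formEval u (baseForm E q)) •
        KaehlerDifferential.D F E ((⇑Differential.deriv)^[k] α) +
      formDiff F u (formDeriv^[k] (fractionForm α p q)) ∈
    spanLT E (fun i => KaehlerDifferential.D F E ((⇑Differential.deriv)^[i] α)) k := by
  set αk := (⇑Differential.deriv)^[k] α
  set ξ := formDeriv^[k] (fractionForm α p q)
  have h1 := D_formEval F u ξ
  have h2 : formEval u ξ - algebraMap F E (-q₀) * αk ∈ affineSpanLT F α k := by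
    rw [formEval_iterate_deriv, h.formEval_fractionForm]
    exact iterate_deriv_sub_mul_mem α p₀ q₀ k
  have h3 := D_mem_spanLT_of_mem_affineSpanLT h2
  have h4 : formCoeffDiff F u (ξ - αk • baseForm E q) ∈
      spanLT E (fun i => KaehlerDifferential.D F E ((⇑Differential.deriv)^[i] α)) k := by
    refine formCoeffDiff_mem F u fun j => D_mem_spanLT_of_mem_affineSpanLT ?_
    rw [Finsupp.sub_apply, Finsupp.smul_apply, baseForm_apply, smul_eq_mul, mul_comm]
    exact iterate_formDeriv_fractionForm_sub_mem α p q k j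
  convert sub_mem h3 h4 using 1
  rw [map_sub, map_sub, formCoeffDiff_smul_baseForm, h1, Derivation.leibniz,
    Derivation.map_algebraMap, map_neg]
  module

theorem spanLT_D_eq (h : IsLinearFraction u α p₀ q₀ p q) (k : ℕ) :
    spanLT E (fun i => KaehlerDifferential.D F E ((⇑Differential.deriv)^[i] α)) k =
      spanLT E (fun i => formDiff F u (formDeriv^[i] (fractionForm α p q))) k :=
  spanLT_eq_of_smul_add_mem h.denom_ne_zero h.smul_D_add_formDiff_mem k

/-- The `dα^(i)` may be replaced by the derivatives of the form, whose leading coefficient stays the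
same nonzero element while the order grows by one each time. -/
theorem spanLT_sup_spanLT_D (h : IsLinearFraction u α p₀ q₀ p q) {m : ℕ}
    (hm : fractionForm α p q m ≠ 0) (hlt : ∀ j, m < j → fractionForm α p q j = 0) (k : ℕ) :
    spanLT E (fun i => KaehlerDifferential.D F E ((⇑Differential.deriv)^[i] u)) m ⊔
        spanLT E (fun i => KaehlerDifferential.D F E ((⇑Differential.deriv)^[i] α)) k =
      spanLT E (fun i => KaehlerDifferential.D F E ((⇑Differential.deriv)^[i] u)) (m + k) := by
  rw [h.spanLT_D_eq]
  refine spanLT_sup_eq_of_sub_mem hm (fun k => ?_) k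
  obtain ⟨h1, h2⟩ := iterate_formDeriv_apply hlt k
  rw [← h1]
  exact formDiff_sub_mem_spanLT h2

/-- If `du` is a linear combination of the differentials of the derivatives of linear fractions
`η i`, then `u` lies in the differential field generated by them. -/
theorem mem_diffAdjoin {ι : Type*} {η : ι → E} {p₀ q₀ : ι → F} {p q : ι → ℕ →₀ F}
    (h : ∀ i, IsLinearFraction u (η i) (p₀ i) (q₀ i) (p i) (q i))
    (hu : LinearIndependent E fun j : ℕ => KaehlerDifferential.D F E ((⇑Differential.deriv)^[j] u))
    (hmem : KaehlerDifferential.D F E u ∈ ⨆ i, span E (Set.range fun k : ℕ =>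
      KaehlerDifferential.D F E ((⇑Differential.deriv)^[k] (η i)))) :
    u ∈ diffAdjoin F (Set.range η) := by
  let S : Set (ℕ →₀ E) := Set.range fun w : ι × ℕ =>
    formDeriv^[w.2] (fractionForm (η w.1) (p w.1) (q w.1))
  have hη : ∀ i, η i ∈ diffAdjoin F (Set.range η) := fun i =>
    iterate_deriv_mem_diffAdjoin (Set.mem_range_self i) 0
  have hclosed : ∀ x ∈ diffAdjoin F (Set.range η),
      Differential.deriv x ∈ diffAdjoin F (Set.range η) := fun x hx => deriv_mem_diffAdjoin hx
  refine mem_of_single_mem_span (S := S) ?_ ?_ ?_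
  · rintro _ ⟨⟨i, k⟩, rfl⟩ j
    refine iterate_formDeriv_apply_mem hclosed (fun j => ?_) k j
    rw [fractionForm, Finsupp.sub_apply, Finsupp.smul_apply, baseForm_apply, baseForm_apply]
    exact sub_mem (mul_mem (hη i) (IntermediateField.algebraMap_mem _ _))
      (IntermediateField.algebraMap_mem _ _)
  · rintro _ ⟨⟨i, k⟩, rfl⟩
    dsimp only
    rw [formEval_iterate_deriv, (h i).formEval_fractionForm]
    exact iterate_deriv_mem_diffAdjoin_of_mem (sub_mem (IntermediateField.algebraMap_mem _ _)
      (mul_mem (hη i) (IntermediateField.algebraMap_mem _ _))) k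
  -- Independence of the `du^(j)` lets the relation for `du` be lifted from differentials back to
  -- forms.
  · have hinj : Function.Injective (formDiff F u) := hu
    have hle : (⨆ i, span E (Set.range fun k : ℕ =>
        KaehlerDifferential.D F E ((⇑Differential.deriv)^[k] (η i)))) ≤
        (span E S).map (formDiff F u) := by
      refine iSup_le fun i => span_le.mpr ?_
      rintro _ ⟨k, rfl⟩
      have h1 := mem_spanLT (K := E)
        (fun k => KaehlerDifferential.D F E ((⇑Differential.deriv)^[k] (η i))) k.lt_succ_self
      rw [(h i).spanLT_D_eq] at h1
      refine span_le.mpr ?_ h1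
      rintro _ ⟨l, _, rfl⟩
      exact mem_map_of_mem (subset_span ⟨(i, l), rfl⟩)
    obtain ⟨ξ, hξ, hξu⟩ := hle hmem
    have : formDiff F u (Finsupp.single 0 1) = KaehlerDifferential.D F E u := by
      simp [formDiff]
    rw [← this] at hξu
    exact hinj hξu ▸ hξ

end IsLinearFraction

end LinearFractions

/-! ### Polynomials of degree at most one -/

section LinearPolynomials

open MvPolynomial

variable {F : Type*} [Field F]

theorem MvPolynomial.eq_zero_or_eq_single_of_mem_support {τ : Type*} {f : MvPolynomial τ F}
    (hf : f.totalDegree ≤ 1) {m : τ →₀ ℕ} (hm : m ∈ f.support) :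
    m = 0 ∨ ∃ w, m = Finsupp.single w 1 := by
  have hdeg : Finsupp.degree m ≤ 1 := (le_totalDegree hm).trans hf
  refine or_iff_not_imp_left.mpr fun h0 => ?_
  obtain ⟨w, hw⟩ := Finsupp.ne_iff.mp h0
  have hle : Finsupp.single w 1 ≤ m := by
    rw [Finsupp.single_le_iff]
    exact Nat.one_le_iff_ne_zero.mpr hw
  have h1 := congrArg Finsupp.degree (add_tsub_cancel_of_le hle)
  rw [map_add, Finsupp.degree_single] at h1
  have h2 : Finsupp.degree (m - Finsupp.single w 1) = 0 := by omega
  rw [Finsupp.degree_eq_zero_iff] at h2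
  exact ⟨w, le_antisymm (tsub_eq_zero_iff_le.mp h2) hle⟩

/-- The coefficients of the linear part of a differential polynomial in one indeterminate. -/
noncomputable def linearCoeff (f : DiffPoly Unit F) : ℕ →₀ F :=
  Finsupp.onFinset (f.vars.image Prod.snd) (fun j => f.coeff (Finsupp.single ((), j) 1))
    fun j hj => Finset.mem_image.mpr ⟨((), j), (mem_vars_iff_mem_support _).mpr
      ⟨_, mem_support_iff.mpr hj, by simp⟩, rfl⟩

theorem linearCoeff_apply (f : DiffPoly Unit F) (j : ℕ) :
    linearCoeff f j = f.coeff (Finsupp.single ((), j) 1) := rfl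

theorem mem_vars_iff_linearCoeff_ne_zero {f : DiffPoly Unit F} (hf : f.totalDegree ≤ 1) {j : ℕ} :
    ((), j) ∈ f.vars ↔ linearCoeff f j ≠ 0 := by
  rw [mem_vars_iff_mem_support]
  constructor
  · rintro ⟨m, hm, hj⟩
    rcases eq_zero_or_eq_single_of_mem_support hf hm with rfl | ⟨w, rfl⟩
    · simp at hj
    · obtain rfl : ((), j) = w := by simpa using hj
      exact mem_support_iff.mp hm
  · exact fun h => ⟨_, mem_support_iff.mpr h, by simp⟩

theorem eq_C_add_sum_linearCoeff {f : DiffPoly Unit F} (hf : f.totalDegree ≤ 1) :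
    f = C (f.coeff 0) + (linearCoeff f).sum fun j c => C c * X ((), j) := by
  classical
  ext m
  rw [coeff_add, Finsupp.sum, coeff_sum]
  simp only [coeff_C_mul, coeff_C, coeff_X]
  by_cases h0 : m = 0
  · subst h0
    rw [if_pos rfl, Finset.sum_eq_zero, add_zero]
    intro j _
    rw [if_neg (by simp), mul_zero]
  · rw [if_neg (Ne.symm h0), zero_add]
    by_cases h1 : ∃ j : ℕ, m = Finsupp.single ((), j) 1
    · obtain ⟨j, rfl⟩ := h1
      rw [Finset.sum_eq_single j]
      · rw [if_pos rfl, mul_one, linearCoeff_apply]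
      · intro i _ hij
        rw [if_neg, mul_zero]
        intro h
        exact hij (congrArg Prod.snd (Finsupp.single_left_injective one_ne_zero h))
      · intro h
        rw [Finsupp.notMem_support_iff.mp h, zero_mul]
    · rw [Finset.sum_eq_zero]
      · by_contra hne
        rcases eq_zero_or_eq_single_of_mem_support hf (mem_support_iff.mpr hne) with h | ⟨w, h⟩
        · exact h0 h
        · exact h1 ⟨w.2, h⟩
      · intro j _
        rw [if_neg fun h => h1 ⟨j, h.symm⟩, mul_zero]

variable {E : Type*} [Field E] [Differential E] [Algebra F E]

theorem evalAt_eq_formEval (u : E) {f : DiffPoly Unit F} (hf : f.totalDegree ≤ 1) :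
    DiffPoly.evalAt (fun _ => u) f =
      algebraMap F E (f.coeff 0) + formEval u (baseForm E (linearCoeff f)) := by
  conv_lhs => rw [eq_C_add_sum_linearCoeff hf]
  rw [DiffPoly.evalAt, map_add, aeval_C, Finsupp.sum, map_sum, formEval,
    Finsupp.linearCombination_apply, baseForm, Finsupp.sum_mapRange_index (by simp), Finsupp.sum]
  simp

theorem IsDiffTranscendental.evalAt_injective {u : E} (hu : IsDiffTranscendental F u) :
    Function.Injective (DiffPoly.evalAt (F := F) fun _ : Unit => u) :=
  AlgebraicIndependent.comp hu (Prod.snd : Unit × ℕ → ℕ)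
    fun _ _ h => Prod.ext rfl h

theorem isLinearFraction_ratPoint {P Q : Fin 2 → DiffPoly Unit F} {u : E}
    (hu : IsDiffTranscendental F u) (hQ : ∀ i, Q i ≠ 0) (hlin : IsLinearRat P Q u) (i : Fin 2) :
    IsLinearFraction u (ratPoint P Q u i) ((P i).coeff 0) ((Q i).coeff 0)
      (linearCoeff (P i)) (linearCoeff (Q i)) where
  denom_ne_zero := by
    rw [← evalAt_eq_formEval u (hlin.degree_denom i)]
    exact (map_ne_zero_iff _ hu.evalAt_injective).mpr (hQ i)
  eq_div := by
    rw [← evalAt_eq_formEval u (hlin.degree_denom i), ← evalAt_eq_formEval u (hlin.degree_num i)]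
    rfl

/-- A reduced differential rational function of order `n` at a differentially transcendental `u`
does not lie in the base field. -/
theorem div_notMem_range_of_mem_vars {p q : DiffPoly Unit F} {u : E}
    (hu : IsDiffTranscendental F u) (hq : q ≠ 0) (hrel : IsRelPrime p q) {w : Unit × ℕ}
    (hw : w ∈ p.vars ∨ w ∈ q.vars) :
    DiffPoly.evalAt (fun _ => u) p / DiffPoly.evalAt (fun _ => u) q ∉
      Set.range (algebraMap F E) := by
  rintro ⟨c, hc⟩
  rw [eq_div_iff ((map_ne_zero_iff _ hu.evalAt_injective).mpr hq)] at hc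
  have hp : p = C c * q := by
    apply hu.evalAt_injective
    rw [map_mul, ← hc]
    congr 1
    exact (aeval_C _ c).symm
  obtain ⟨a, _, rfl⟩ := isUnit_iff_eq_C_of_isReduced.mp (hrel ⟨C c, by rw [hp, mul_comm]⟩ dvd_rfl)
  rw [hp, ← C_mul, vars_C, vars_C] at hw
  simp at hw

/-- If the coefficient `α q_n - p_n` vanished with `q_n ≠ 0`, then `α` would lie in `F`, contrary to
reducedness with a variable present; if `q_n = 0`, then `p_n ≠ 0`. -/
theorem fractionForm_ratPoint {P Q : Fin 2 → DiffPoly Unit F} {u : E}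
    (hu : IsDiffTranscendental F u) (hQ : ∀ i, Q i ≠ 0) (hrel : ∀ i, IsRelPrime (P i) (Q i))
    (hlin : IsLinearRat P Q u) {i : Fin 2} {n : ℕ} (hn : ratOrd (P i) (Q i) = n) :
    fractionForm (ratPoint P Q u i) (linearCoeff (P i)) (linearCoeff (Q i)) n ≠ 0 ∧
      ∀ j, n < j →
        fractionForm (ratPoint P Q u i) (linearCoeff (P i)) (linearCoeff (Q i)) j = 0 := by
  have happ : ∀ j, fractionForm (ratPoint P Q u i) (linearCoeff (P i)) (linearCoeff (Q i)) j =
      ratPoint P Q u i * algebraMap F E (linearCoeff (Q i) j) -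
        algebraMap F E (linearCoeff (P i) j) := fun j => by
    rw [fractionForm, Finsupp.sub_apply, Finsupp.smul_apply, baseForm_apply, baseForm_apply,
      smul_eq_mul]
  have hle : ∀ j, ((), j) ∈ (P i).vars ∨ ((), j) ∈ (Q i).vars → j ≤ n := by
    rintro j (h | h)
    · exact WithBot.coe_le_coe.mp ((DiffPoly.le_ord h).trans ((le_max_left _ _).trans hn.le))
    · exact WithBot.coe_le_coe.mp ((DiffPoly.le_ord h).trans ((le_max_right _ _).trans hn.le))
  have hmem : ((), n) ∈ (P i).vars ∨ ((), n) ∈ (Q i).vars := by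
    rcases max_choice (DiffPoly.ord () (P i)) (DiffPoly.ord () (Q i)) with h | h
    · exact Or.inl (DiffPoly.mem_vars_of_ord_eq (h.symm.trans hn))
    · exact Or.inr (DiffPoly.mem_vars_of_ord_eq (h.symm.trans hn))
  constructor
  · rw [happ]
    intro h0
    by_cases hq : linearCoeff (Q i) n = 0
    · rw [hq, map_zero, mul_zero, zero_sub, neg_eq_zero, map_eq_zero] at h0
      rcases hmem with h | h
      · exact (mem_vars_iff_linearCoeff_ne_zero (hlin.degree_num i)).mp h h0
      · exact (mem_vars_iff_linearCoeff_ne_zero (hlin.degree_denom i)).mp h hq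
    · refine div_notMem_range_of_mem_vars hu (hQ i) (hrel i) hmem
        ⟨linearCoeff (P i) n / linearCoeff (Q i) n, ?_⟩
      rw [map_div₀, div_eq_iff ((map_ne_zero _).mpr hq)]
      exact (sub_eq_zero.mp h0).symm
  · intro j hj
    have hP : linearCoeff (P i) j = 0 := by
      by_contra h
      exact hj.not_ge (hle j (Or.inl ((mem_vars_iff_linearCoeff_ne_zero (hlin.degree_num i)).mpr h)))
    have hQ : linearCoeff (Q i) j = 0 := by
      by_contra h
      exact hj.not_ge
        (hle j (Or.inr ((mem_vars_iff_linearCoeff_ne_zero (hlin.degree_denom i)).mpr h)))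
    rw [happ, hP, hQ, map_zero, mul_zero, sub_zero]

theorem ratPoint_mem_range_of_ratOrd_eq_bot {P Q : Fin 2 → DiffPoly Unit F} {u : E} {i : Fin 2}
    (h : ratOrd (P i) (Q i) = ⊥) : ratPoint P Q u i ∈ Set.range (algebraMap F E) := by
  obtain ⟨hP, hQ⟩ := max_eq_bot.mp h
  have key : ∀ f : DiffPoly Unit F, DiffPoly.ord () f = ⊥ →
      DiffPoly.evalAt (fun _ => u) f = algebraMap F E (f.coeff 0) := by
    intro f hf
    have : f.vars = ∅ :=
      Finset.eq_empty_of_forall_notMem fun w => DiffPoly.notMem_vars_of_ord_eq_bot hf w.2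
    conv_lhs => rw [vars_eq_empty_iff_eq_C.mp this]
    exact aeval_C _ _
  exact ⟨(P i).coeff 0 / (Q i).coeff 0, by rw [map_div₀, ratPoint, key _ hP, key _ hQ]⟩

end LinearPolynomials

/-! ### Properness and membership of `u` -/

section Properness

open Submodule

variable {F E : Type*} [Field F] [Field E] [Differential E] [Algebra F E]

theorem D_mem_of_isProperParam {P Q : Fin 2 → DiffPoly Unit F} {u : E}
    (h : IsProperParam P Q u) (j : ℕ) :
    KaehlerDifferential.D F E ((⇑Differential.deriv)^[j] u) ∈
      ⨆ i, span E (Set.range fun k => DiffPoly.diffAt F (ratPoint P Q u) (i, k)) := by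
  have h1 := iterate_deriv_mem_diffAdjoin (F := F) (Set.mem_singleton u) j
  rw [← h] at h1
  refine span_le.mpr ?_ (IntermediateField.D_mem_span_of_mem_adjoin h1)
  rintro _ ⟨_, ⟨_, ⟨i, rfl⟩, k, rfl⟩, rfl⟩
  exact mem_iSup_of_mem i (subset_span ⟨k, rfl⟩)

theorem isProperParam_of_mem [Differential F] [DifferentialAlgebra F E] {P Q : Fin 2 → DiffPoly Unit F} {u : E}
    (h : u ∈ diffAdjoin F (Set.range (ratPoint P Q u))) : IsProperParam P Q u := by
  have heval : ∀ f : DiffPoly Unit F, DiffPoly.evalAt (fun _ => u) f ∈ diffAdjoin F {u} := by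
    intro f
    induction f using MvPolynomial.induction_on with
    | C a =>
      rw [DiffPoly.evalAt, MvPolynomial.aeval_C]
      exact IntermediateField.algebraMap_mem _ _
    | add p q hp hq => rw [map_add]; exact add_mem hp hq
    | mul_X p w hp =>
      rw [map_mul]
      refine mul_mem hp ?_
      rw [DiffPoly.evalAt, MvPolynomial.aeval_X]
      exact iterate_deriv_mem_diffAdjoin (Set.mem_singleton u) _
  apply le_antisymm
  · refine diffAdjoin_le ?_
    rintro _ ⟨i, rfl⟩
    exact div_mem (heval _) (heval _)
  · refine diffAdjoin_le ?_
    rintro _ rfl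
    exact h

end Properness

/-! ### Comparing the two sides -/

section Main

open Submodule Module

theorem iSup_fin_two_of_ne {α : Type*} [CompleteLattice α] (f : Fin 2 → α) {i j : Fin 2}
    (h : i ≠ j) : ⨆ k, f k = f i ⊔ f j := by
  apply le_antisymm
  · refine iSup_le fun k => ?_
    rcases (by omega : k = i ∨ k = j) with rfl | rfl
    · exact le_sup_left
    · exact le_sup_right
  · exact sup_le (le_iSup f i) (le_iSup f j)

namespace DiffPoly

variable {F E : Type*} [Field F] [Field E] [Differential E] [Algebra F E]

theorem span_diffAt_orderFamily (η : Fin 2 → E) {i j : Fin 2} (h : i ≠ j) (c d k : ℕ) :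
    span E (diffAt F η '' orderFamily i c d k) =
      spanLT E (fun n => diffAt F η (i, n)) (c + k) ⊔
        spanLT E (fun n => diffAt F η (j, n)) (d + k) := by
  rw [spanLT, spanLT, ← span_union]
  congr 1
  ext x
  constructor
  · rintro ⟨⟨l, n⟩, ⟨rfl, hn⟩ | ⟨hl, hn⟩, rfl⟩
    · exact Or.inl ⟨n, hn, rfl⟩
    · obtain rfl : l = j := by dsimp only at hl; omega
      exact Or.inr ⟨n, hn, rfl⟩
  · rintro (⟨n, hn, rfl⟩ | ⟨n, hn, rfl⟩)
    · exact ⟨(i, n), Or.inl ⟨rfl, hn⟩, rfl⟩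
    · exact ⟨(j, n), Or.inr ⟨h.symm, hn⟩, rfl⟩

variable [CharZero F] [Differential F] {r : Fin 2 × ℕ → Fin 2 × ℕ → Prop}
  {A : DiffPoly (Fin 2) F} {v : Fin 2 × ℕ} {η : Fin 2 → E}

theorem diffAt_mem_spanLT [DifferentialAlgebra F E] (hA : Irreducible A) (hr : IsRanking r)
    (hv : IsLeader r A v) (h : vanishingIdeal F η = sat A v) {i j : Fin 2} (hij : i ≠ j) {c d : ℕ}
    (hc : ord i A = c) (hd : ∀ k, (j, k) ∈ A.vars → k < d) (k : ℕ) :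
    diffAt F η (i, c + k) ∈ spanLT E (fun n => diffAt F η (i, n)) (c + k) ⊔
        spanLT E (fun n => diffAt F η (j, n)) (d + k) := by
  rw [← span_diffAt_orderFamily η hij]
  refine diffAt_mem_span (isLowerFamily_orderFamily i c d) (A := A) ?_
    (evalAt_eq_zero_of_generic h) (evalAt_pderiv_ne_zero hA hr hv h (mem_vars_of_ord_eq hc)) k
  rw [MvPolynomial.mem_supported]
  rintro ⟨l, n⟩ hl
  by_cases hli : l = i
  · subst hli
    rcases (le_of_ord_eq hc hl).eq_or_lt with rfl | hlt
    · exact Or.inl rfl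
    · exact Or.inr (Or.inl ⟨rfl, hlt⟩)
  · obtain rfl : l = j := by omega
    exact Or.inr (Or.inr ⟨hli, hd n hl⟩)

/-- These differentials come from derivatives that are algebraically independent at a generic point.
-/
theorem finrank_spanLT_sup_of_leader (hA : Irreducible A) (hr : IsRanking r)
    (hv : IsLeader r A v) (h : vanishingIdeal F η = sat A v) {j : Fin 2} (hj : j ≠ v.1) (N : ℕ) :
    finrank E ↥(spanLT E (fun n => diffAt F η (j, n)) N ⊔
      spanLT E (fun n => diffAt F η (v.1, n)) v.2) = N + v.2 := by
  refine finrank_spanLT_sup ?_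
  have h1 := (algebraicIndependent_of_generic hA hr hv h).linearIndependent_D
  have h2 := h1.comp (Sum.elim (fun n : Fin N => ⟨(j, n), Or.inl hj⟩)
    (fun n : Fin v.2 => ⟨(v.1, n), Or.inr n.2⟩)) (by
      rintro (a | a) (b | b) hab
      · exact congrArg Sum.inl (Fin.ext (congrArg (fun w => w.1.2) hab))
      · exact absurd (congrArg (fun w => w.1.1) hab) hj
      · exact absurd (congrArg (fun w => w.1.1) hab).symm hj
      · exact congrArg Sum.inr (Fin.ext (congrArg (fun w => w.1.2) hab)))
  convert h2 using 1
  funext x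
  rcases x with x | x <;> rfl

/-- The formula is symmetric, so `j` may be taken as the indeterminate of the leader. Its
derivatives of order at least `b` are then redundant, and an independent family remains. -/
theorem finrank_spanLT_sup_of_ord_eq [DifferentialAlgebra F E] (hA : Irreducible A)
    (hr : IsRanking r) (hv : IsLeader r A v) (h : vanishingIdeal F η = sat A v) {i j : Fin 2}
    (hij : i ≠ j) {a b : ℕ} (ha : ord i A = a) (hb : ord j A = b) (k : ℕ) :
    finrank E ↥(spanLT E (fun n => diffAt F η (i, n)) (a + k) ⊔
      spanLT E (fun n => diffAt F η (j, n)) (b + k)) = a + b + k := by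
  wlog hvj : v.1 = j generalizing i j a b
  · rw [sup_comm, this hij.symm hb ha (by omega)]
    omega
  have hrel := diffAt_mem_spanLT hA hr hv h hij.symm (d := a + 1) hb
    fun k hk => Nat.lt_succ_of_le (le_of_ord_eq ha hk)
  have hvb : v.2 = b := by
    have := hv.ord_eq hr
    rw [hvj, hb] at this
    exact (WithBot.coe_injective this).symm
  rw [spanLT_sup_eq_left fun k => by
    have := hrel k
    rwa [sup_comm, add_right_comm] at this]
  have := finrank_spanLT_sup_of_leader hA hr hv h (j := i) (by omega) (a + k)
  rw [hvj, hvb] at this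
  rw [this]
  omega

end DiffPoly

open DiffPoly

variable {F : Type*} [Field F] [Differential F]
  {E : Type*} [Field E] [Differential E] [Algebra F E] [DifferentialAlgebra F E]
  {u : E} {A : DiffPoly (Fin 2) F} {r : Fin 2 × ℕ → Fin 2 × ℕ → Prop} {v : Fin 2 × ℕ}
  {P Q : Fin 2 → DiffPoly Unit F}

theorem spanLT_sup_spanLT_diffAt (hu : IsDiffTranscendental F u)
    (hP : IsRatParametrization A v P Q u) (hlin : IsLinearRat P Q u) {i : Fin 2} {n : ℕ}
    (hn : ratOrd (P i) (Q i) = n) (k : ℕ) :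
    spanLT E (fun j => KaehlerDifferential.D F E ((⇑Differential.deriv)^[j] u)) n ⊔
        spanLT E (fun k => diffAt F (ratPoint P Q u) (i, k)) k =
      spanLT E (fun j => KaehlerDifferential.D F E ((⇑Differential.deriv)^[j] u)) (n + k) := by
  obtain ⟨h1, h2⟩ := fractionForm_ratPoint hu hP.denom_ne_zero hP.reduced hlin hn
  exact (isLinearFraction_ratPoint hu hP.denom_ne_zero hlin i).spanLT_sup_spanLT_D h1 h2 k

variable [CharZero F]

/-- For a linear parametrization, properness can be read off from differentials. -/
theorem isProperParam_iff_D_mem (hu : IsDiffTranscendental F u)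
    (hP : IsRatParametrization A v P Q u) (hlin : IsLinearRat P Q u) :
    IsProperParam P Q u ↔ KaehlerDifferential.D F E u ∈
      ⨆ i, span E (Set.range fun k => diffAt F (ratPoint P Q u) (i, k)) :=
  ⟨fun h => D_mem_of_isProperParam h 0, fun h => isProperParam_of_mem
    (IsLinearFraction.mem_diffAdjoin
      (fun i => isLinearFraction_ratPoint hu hP.denom_ne_zero hlin i)
      (AlgebraicIndependent.linearIndependent_D hu) h)⟩

/-- The case of a constant component. -/
theorem isProperParam_iff_of_ratOrd_eq_bot (hu : IsDiffTranscendental F u) (hA : Irreducible A)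
    (hr : IsRanking r) (hv : IsLeader r A v) (hP : IsRatParametrization A v P Q u)
    (hlin : IsLinearRat P Q u) {i j : Fin 2} (hij : i ≠ j) (hi : ratOrd (P i) (Q i) = ⊥) {n : ℕ}
    (hn : ratOrd (P j) (Q j) = n) :
    ord i A = (0 : ℕ) ∧ ord j A = ⊥ ∧ (IsProperParam P Q u ↔ n = 0) := by
  obtain ⟨c, hc⟩ := ratPoint_mem_range_of_ratOrd_eq_bot (u := u) hi
  -- Since `A` divides this polynomial, its only variable is `(i, 0)`; this fixes both orders of
  -- `A`.
  let f : DiffPoly (Fin 2) F := MvPolynomial.X (i, 0) - MvPolynomial.C c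
  have hf0 : evalAt (ratPoint P Q u) f = 0 := by
    rw [map_sub, evalAt, MvPolynomial.aeval_X, MvPolynomial.aeval_C, hc]
    exact sub_self _
  have hfs : f ∈ MvPolynomial.supported F {((i, 0) : Fin 2 × ℕ)} :=
    sub_mem (MvPolynomial.X_mem_supported.mpr rfl) (Subalgebra.algebraMap_mem _ _)
  have hfvars := MvPolynomial.mem_supported.mp hfs
  have hfne : f ≠ 0 := fun h => by
    have := congrArg (MvPolynomial.coeff (Finsupp.single (i, 0) 1)) h
    have h0 : (0 : Fin 2 × ℕ →₀ ℕ) ≠ Finsupp.single (i, 0) 1 :=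
      (Finsupp.single_ne_zero.mpr one_ne_zero).symm
    simp [f, MvPolynomial.coeff_C, h0] at this
  have hAf : A.vars ⊆ f.vars := MvPolynomial.vars_subset_of_dvd
    (dvd_of_evalAt_eq_zero hA hr hv hP.generic hf0 fun k hk => by
      have := congrArg Prod.snd (hfvars hk : _ = (i, 0))
      simp at this) hfne
  have hAvars : ∀ w ∈ A.vars, w = (i, 0) := fun w hw => hfvars (hAf hw)
  have hmem : (i, 0) ∈ A.vars := hAvars v hv.1 ▸ hv.1
  refine ⟨ord_eq_coe_iff.mpr ⟨hmem, fun k hk => ?_⟩, ord_eq_bot_iff.mpr fun k hk => ?_, ?_⟩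
  · exact (congrArg Prod.snd (hAvars _ hk)).le
  · exact hij (congrArg Prod.fst (hAvars _ hk)).symm
  have hzero : span E (Set.range fun k => diffAt F (ratPoint P Q u) (i, k)) = ⊥ := by
    have hiter : ∀ k, ∃ d : F,
        (⇑Differential.deriv)^[k] (algebraMap F E c) = algebraMap F E d := by
      intro k
      induction k with
      | zero => exact ⟨c, rfl⟩
      | succ k ih =>
        obtain ⟨d, hd⟩ := ih
        exact ⟨_, by rw [Function.iterate_succ_apply', hd, deriv_algebraMap]⟩
    rw [span_eq_bot]
    rintro _ ⟨k, rfl⟩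
    obtain ⟨d, hd⟩ := hiter k
    change KaehlerDifferential.D F E ((⇑Differential.deriv)^[k] (ratPoint P Q u i)) = 0
    rw [← hc, hd, Derivation.map_algebraMap]
  have hD := AlgebraicIndependent.linearIndependent_D hu
  have hspan := spanLT_sup_spanLT_diffAt hu hP hlin hn
  constructor
  · intro h
    refine eq_zero_of_sup_spanLT_of_mem hD hspan fun l => ?_
    have := D_mem_of_isProperParam h l
    rwa [iSup_fin_two_of_ne _ hij, hzero, bot_sup_eq] at this
  · rintro rfl
    rw [isProperParam_iff_D_mem hu hP hlin]
    -- For `n = 0` the first differential of the nonconstant component already spans the line of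
    -- `du`.
    have h1 := hspan 1
    rw [spanLT_zero, bot_sup_eq] at h1
    refine mem_iSup_of_mem j (spanLT_le_span_range _ 1 ?_)
    have h2 := mem_spanLT (K := E)
      (fun j => KaehlerDifferential.D F E ((⇑Differential.deriv)^[j] u)) (Nat.succ_pos 0)
    rwa [← zero_add (Nat.succ 0), ← h1] at h2

/-- Otherwise `A` would be a differential equation in the `i`-th indeterminate alone, making one
differential of the `i`-th component depend on the preceding ones, which its dependence on `u`
forbids. -/
theorem ord_ne_bot_of_ratOrd_eq_coe (hu : IsDiffTranscendental F u) (hA : Irreducible A)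
    (hr : IsRanking r) (hv : IsLeader r A v) (hP : IsRatParametrization A v P Q u)
    (hlin : IsLinearRat P Q u) {i j : Fin 2} (hij : i ≠ j) {n : ℕ}
    (hn : ratOrd (P i) (Q i) = n) : ord j A ≠ ⊥ := by
  intro hj
  have hvi : v.1 = i := by
    by_contra h
    refine notMem_vars_of_ord_eq_bot hj v.2 ?_
    obtain rfl : v.1 = j := by omega
    exact hv.1
  have hi := hv.ord_eq hr
  rw [hvi] at hi
  have h1 := diffAt_mem_spanLT hA hr hv hP.generic hij (d := 0) hi
    (fun k hk => absurd hk (notMem_vars_of_ord_eq_bot hj k)) 0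
  rw [spanLT_zero, sup_bot_eq] at h1
  exact notMem_spanLT_of_sup_spanLT (AlgebraicIndependent.linearIndependent_D hu)
    (spanLT_sup_spanLT_diffAt hu hP hlin hn) _ h1

/-- The case of two nonconstant components. -/
theorem isProperParam_iff_of_ratOrd_eq_coe (hu : IsDiffTranscendental F u) (hA : Irreducible A)
    (hr : IsRanking r) (hv : IsLeader r A v) (hP : IsRatParametrization A v P Q u)
    (hlin : IsLinearRat P Q u) {m n a b : ℕ} (hm : ratOrd (P 0) (Q 0) = m)
    (hn : ratOrd (P 1) (Q 1) = n) (ha : ord 0 A = a) (hb : ord 1 A = b) :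
    IsProperParam P Q u ↔ m = b ∧ n = a := by
  have h01 : (0 : Fin 2) ≠ 1 := by decide
  have hD := AlgebraicIndependent.linearIndependent_D hu
  have hx := spanLT_sup_spanLT_diffAt hu hP hlin hm
  have hy := spanLT_sup_spanLT_diffAt hu hP hlin hn
  have hdim := finrank_spanLT_sup_of_ord_eq hA hr hv hP.generic h01 ha hb
  have hdim' := finrank_spanLT_sup_of_ord_eq hA hr hv hP.generic h01.symm hb ha
  have hyx := diffAt_mem_spanLT hA hr hv hP.generic h01.symm (d := a + 1) hb
    fun k hk => Nat.lt_succ_of_le (le_of_ord_eq ha hk)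
  have hxy := diffAt_mem_spanLT hA hr hv hP.generic h01 (d := b + 1) ha
    fun k hk => Nat.lt_succ_of_le (le_of_ord_eq hb hk)
  constructor
  · intro h
    constructor
    · refine eq_of_sup_spanLT_of_mem hD hx hy (fun k => ?_) hdim fun j => ?_
      · rw [sup_comm, add_right_comm]; exact hyx k
      · have := D_mem_of_isProperParam h j
        rwa [iSup_fin_two_of_ne _ h01] at this
    · refine eq_of_sup_spanLT_of_mem hD hy hx (fun k => ?_) hdim' fun j => ?_
      · rw [sup_comm, add_right_comm]; exact hxy k
      · have := D_mem_of_isProperParam h j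
        rwa [iSup_fin_two_of_ne _ h01.symm] at this
  · rintro ⟨rfl, rfl⟩
    rw [isProperParam_iff_D_mem hu hP hlin, iSup_fin_two_of_ne _ h01]
    exact mem_span_sup_of_sup_spanLT hD hx hy hdim

end Main

theorem mainTheorem6 {F : Type*} [Field F] [CharZero F] [Differential F]
    {E : Type*} [Field E] [Differential E] [Algebra F E] [DifferentialAlgebra F E]
    (u : E) (hu : IsDiffTranscendental F u)
    (A : DiffPoly (Fin 2) F) (hA : Irreducible A)
    (r : Fin 2 × ℕ → Fin 2 × ℕ → Prop) (hr : DiffPoly.IsRanking r)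
    (v : Fin 2 × ℕ) (hv : DiffPoly.IsLeader r A v)
    (P Q : Fin 2 → DiffPoly Unit F)
    (hP : IsRatParametrization A v P Q u) (hlin : IsLinearRat P Q u) :
    IsProperParam P Q u ↔
      ratOrd (P 0) (Q 0) = DiffPoly.ord 1 A ∧ ratOrd (P 1) (Q 1) = DiffPoly.ord 0 A := by
  have h01 : (0 : Fin 2) ≠ 1 := by decide
  have hcases : ∀ x : WithBot ℕ, x = ⊥ ∨ ∃ n : ℕ, x = n := fun x =>
    (eq_or_ne x ⊥).imp_right fun h => (WithBot.ne_bot_iff_exists.mp h).imp fun _ => Eq.symm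
  rcases hcases (ratOrd (P 0) (Q 0)) with h0 | ⟨m, hm⟩ <;>
    rcases hcases (ratOrd (P 1) (Q 1)) with h1 | ⟨n, hn⟩
  · exact absurd (Fin.forall_fin_two.mpr ⟨ratPoint_mem_range_of_ratOrd_eq_bot h0,
      ratPoint_mem_range_of_ratOrd_eq_bot h1⟩) hlin.not_const
  -- With a constant component, one of the two order equalities reads `-∞ = -∞`; the other says that
  -- the nonconstant component has order zero.
  · obtain ⟨hx, hy, h⟩ := isProperParam_iff_of_ratOrd_eq_bot hu hA hr hv hP hlin h01 h0 hn
    rw [h, h0, hn, hx, hy, Nat.cast_inj]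
    simp
  · obtain ⟨hy, hx, h⟩ := isProperParam_iff_of_ratOrd_eq_bot hu hA hr hv hP hlin h01.symm h1 hm
    rw [h, h1, hm, hx, hy, Nat.cast_inj]
    simp
  · obtain ⟨b, hb⟩ := (hcases _).resolve_left
      (ord_ne_bot_of_ratOrd_eq_coe hu hA hr hv hP hlin h01 hm)
    obtain ⟨a, ha⟩ := (hcases _).resolve_left
      (ord_ne_bot_of_ratOrd_eq_coe hu hA hr hv hP hlin h01.symm hn)
    rw [isProperParam_iff_of_ratOrd_eq_coe hu hA hr hv hP hlin hm hn ha hb, hm, hn,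
      ha, hb, Nat.cast_inj, Nat.cast_inj]
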